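/- Let $X$ be an analytic subset of a complete separable metric space, let $Y$ be a separable metric space (both with their Borel $\sigma$-algebras), let $(\Lambda,\mathcal P)$ be a probability space, and let $\pi:\Lambda\times X\to Y$ be measurable; write $\pi_\lambda=\pi(\lambda,\cdot)$. Suppose that for some real numbers $\alpha,\kappa,C>0$ the transversality property $$\mathcal P\big[\lambda\in\Lambda:\ d(\pi_\lambda(x_1),\pi_\lambda(x_2))\le\delta\, d(x_1,x_2)^{\alpha}\big]\le C\delta^{\kappa}$$ holds for all $\delta>0$ and all $x_1\ne x_2$ in $X$. Suppose that $\dim X>\alpha\kappa$, where $\dim$ is the Hausdorff dimension. A Borel measure $\eta$ on $Y$ is called $\kappa$-regular if it is outer regular by open sets and $\liminf_{r\to0^+}\eta(B(y,r))/r^\kappa>0$ for every $y\in Y$. It is called strongly $\kappa$-regular if it is outer regular by open sets and there is $c>0$ with $\liminf_{r\to0^+}\eta(B(y,r))/r^\kappa\ge c$ for every $y\in Y$. Here $\eta(A)$ for an arbitrary set $A\subset Y$ denotes the outer measure. (i) If $\eta$ is a $\kappa$-regular measure on $Y$, then $\eta(\pi_\lambda(X))>0$ for $\mathcal P$-a.e.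 $\lambda\in\Lambda$. (ii) If $\eta$ is a strongly $\kappa$-regular and $\sigma$-finite measure on $Y$, then $\lambda\mapsto\eta(\pi_\lambda(X))^{-1}\in[0,\infty]$ is measurable with respect to the completion of $\mathcal P$, and $$\int_\Lambda\eta(\pi_\lambda(X))^{-1}\,d\mathcal P(\lambda)<\infty .$$ -/

import Mathlib

open MeasureTheory Filter
open scoped Topology ENNReal

noncomputable section

/-- The lower `κ`-density `liminf_{r → 0⁺} η(B(y, r)) / r ^ κ`, as an element of `[0, ∞]`,
with `B(y, r)` the closed ball. -/
def kappaDensity {Y : Type*} [MetricSpace Y] [MeasurableSpace Y]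
    (κ : ℝ) (η : Measure Y) (y : Y) : ℝ≥0∞ :=
  liminf (fun r : ℝ => η (Metric.closedBall y r) / ENNReal.ofReal (r ^ κ)) (𝓝[>] (0 : ℝ))

/-- A `κ`-regular Borel measure: outer regular by open sets, with positive lower `κ`-density at
every point. -/
structure IsKappaRegular {Y : Type*} [MetricSpace Y] [MeasurableSpace Y] [BorelSpace Y]
    (κ : ℝ) (η : Measure Y) : Prop where
  outerRegular : η.OuterRegular
  density_pos : ∀ y : Y, 0 < kappaDensity κ η y

/-- A strongly `κ`-regular Borel measure: outer regular by open sets, with lower `κ`-density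
bounded below by one positive constant at all points. -/
structure IsStronglyKappaRegular {Y : Type*} [MetricSpace Y] [MeasurableSpace Y] [BorelSpace Y]
    (κ : ℝ) (η : Measure Y) : Prop where
  outerRegular : η.OuterRegular
  density_ge : ∃ c : ℝ≥0∞, 0 < c ∧ ∀ y : Y, c ≤ kappaDensity κ η y

/-- Transversality of the family `π ω : X → Y`, `ω ∈ Λ`, with parameters `α`, `κ`, `C`.
The points are distinct: for `x₁ = x₂` the event is all of `Λ`. -/
def IsTransversal {X Y Λ : Type*} [MetricSpace X] [MetricSpace Y] [MeasurableSpace Λ]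
    (P : Measure Λ) (π : Λ → X → Y) (α κ C : ℝ) : Prop :=
  ∀ δ : ℝ, 0 < δ → ∀ x₁ x₂ : X, x₁ ≠ x₂ →
    P {ω | dist (π ω x₁) (π ω x₂) ≤ δ * dist x₁ x₂ ^ α} ≤ ENNReal.ofReal (C * δ ^ κ)

end

/-! Write `X` as the image of Baire space under a continuous `f`, and pick `t` with `α * κ < t < dim
X`. A Frostman lemma (`exists_measure_energy_lt_top`) gives a probability measure `μ` on Baire space
for which the `α * κ`-energy of `f` is finite. Taking `δ = r * d(x₁, x₂) ^ (-α)`, transversality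
says that `π_λ x₁` and `π_λ x₂` are within `r` with probability at most `C * r ^ κ * d(x₁, x₂) ^
(-(α * κ))`. By Tonelli and Fatou (`lintegral_imageDensity_le`), the lower `κ`-density of the image
of `μ` under `π_λ`, averaged over `μ` and then over `λ`, is at most `C` times the energy. So for
almost every `λ` this density has a finite average `J`. Where the image measure has small density
and `η` has large density, Vitali's covering lemma bounds the image measure by a multiple of `η`
(`measure_le_of_density`). This makes `η (π_λ X)` positive, and Markov's inequality turns it into `η
(π_λ X)⁻¹ ≲ 2 * J + 1`, which is integrable in `λ`.

The Frostman lemma comes from a random path in a tree of pairs (point of Baire space, radius). A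
node is good if its piece of the image has Hausdorff content comparable to `r ^ t`. Good nodes exist
around all points outside a content-null set. The children of a good node are well separated much
smaller good nodes, weighted greedily so that the weight is `t`-dimensional (`exists_isChildLaw`).
Each generation loses a factor `K`. Since `K` is independent of the ratio `θ` of successive radii, a
small `θ` makes `K * θ ^ (t - s) ≤ 1 / 2`, and the potentials, split by the generation at which two
paths part, are geometric series. -/

noncomputable section

open Metric Set

/-! ### Hausdorff content, its density points, and good nodes. -/

section Content

variable {E : Type*} [MetricSpace E]

/-- The `t`-dimensional Hausdorff content. -/
def hausdorffContent (E : Type*) [MetricSpace E] (t : ℝ) (ht : 0 < t) : OuterMeasure E :=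
  OuterMeasure.ofFunction (fun U => ediam U ^ t) (by simp [ht])

lemma hausdorffContent_le_ediam_rpow {t : ℝ} (ht : 0 < t) (U : Set E) :
    hausdorffContent E t ht U ≤ ediam U ^ t :=
  OuterMeasure.ofFunction_le U

lemma exists_cover_of_hausdorffContent_lt {t : ℝ} (ht : 0 < t) {A : Set E} {b : ℝ≥0∞}
    (h : hausdorffContent E t ht A < b) :
    ∃ U : ℕ → Set E, A ⊆ ⋃ n, U n ∧ ∑' n, ediam (U n) ^ t < b := by
  rw [hausdorffContent, OuterMeasure.ofFunction_apply] at h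
  simpa only [iInf_lt_iff, exists_prop] using h

/-- A cover with `∑ diam ^ t` below `ε` has all diameters at most `ε ^ (1 / t)`, so covers that are
nearly optimal for the content are automatically fine. -/
lemma hausdorffMeasure_eq_zero_of_hausdorffContent_eq_zero [MeasurableSpace E] [BorelSpace E]
    {t : ℝ} (ht : 0 < t) {A : Set E} (h : hausdorffContent E t ht A = 0) : μH[t] A = 0 := by
  have hex : ∀ n : ℕ, ∃ U : ℕ → Set E, A ⊆ ⋃ i, U i ∧
      ∑' i, ediam (U i) ^ t < ((n : ℝ≥0∞) + 1)⁻¹ := fun n =>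
    exists_cover_of_hausdorffContent_lt ht (by rw [h]; simp)
  choose U hU hUs using hex
  have hlim : Tendsto (fun n : ℕ => ((n : ℝ≥0∞) + 1)⁻¹) atTop (𝓝 0) := by
    have := (tendsto_add_atTop_iff_nat 1).2 ENNReal.tendsto_inv_nat_nhds_zero
    simpa using this
  have hr : Tendsto (fun n : ℕ => (((n : ℝ≥0∞) + 1)⁻¹) ^ t⁻¹) atTop (𝓝 0) := by
    have := (ENNReal.continuous_rpow_const (y := t⁻¹)).tendsto 0
    rw [ENNReal.zero_rpow_of_pos (inv_pos.2 ht)] at this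
    exact this.comp hlim
  have := Measure.hausdorffMeasure_le_liminf_tsum (l := atTop) t A _ hr U
    (Eventually.of_forall fun n i => by
      rw [← ENNReal.rpow_le_rpow_iff ht, ← ENNReal.rpow_mul, inv_mul_cancel₀ ht.ne',
        ENNReal.rpow_one]
      exact (ENNReal.le_tsum i).trans (hUs n).le)
    (Eventually.of_forall fun n => hU n)
  refine le_antisymm (this.trans ?_) zero_le
  rw [← hlim.liminf_eq]
  exact liminf_le_liminf (Eventually.of_forall fun n => (hUs n).le)

lemma ediam_closedBall_le_ofReal (x : E) (r : ℝ) :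
    ediam (closedBall x r) ≤ ENNReal.ofReal (2 * r) := by
  refine ediam_le fun y hy z hz => ?_
  rw [edist_dist]
  refine ENNReal.ofReal_le_ofReal ?_
  have := dist_triangle_right y z x
  rw [mem_closedBall] at hy hz
  linarith

/-- Points of `A` at which `A` has small `t`-content in all balls of radius at most `r₀` form a
content-null set. -/
lemma hausdorffContent_sparse_eq_zero [TopologicalSpace.SeparableSpace E] {t : ℝ} (ht : 0 < t)
    (A : Set E) {r₀ : ℝ} (hr₀ : 0 < r₀) :
    hausdorffContent E t ht {x ∈ A | ∀ r : ℝ, 0 < r → r ≤ r₀ →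
      hausdorffContent E t ht (A ∩ closedBall x r) ≤ ENNReal.ofReal r ^ t / 2} = 0 := by
  set H := hausdorffContent E t ht with hH
  set G := {x ∈ A | ∀ r : ℝ, 0 < r → r ≤ r₀ →
      H (A ∩ closedBall x r) ≤ ENNReal.ofReal r ^ t / 2} with hG
  -- Localizing to small diameter makes the content finite and puts every piece of a cover inside a
  -- ball of admissible radius about one of its points. Each piece then has content at most half of
  -- `diam ^ t`, so a cover with sum below twice the content would give a content below itself.
  have key : ∀ Q : Set E, ediam Q ≤ ENNReal.ofReal r₀ → H (G ∩ Q) = 0 := by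
    intro Q hQ
    have hfin : H (G ∩ Q) ≠ ∞ := by
      refine ne_top_of_le_ne_top ?_ (hausdorffContent_le_ediam_rpow ht (G ∩ Q))
      refine ENNReal.rpow_ne_top_of_nonneg ht.le ?_
      exact ne_top_of_le_ne_top ENNReal.ofReal_ne_top ((ediam_mono inter_subset_right).trans hQ)
    have hpiece : ∀ U : Set E, H (G ∩ Q ∩ U) ≤ ediam U ^ t / 2 := by
      intro U
      have hmono : ediam (G ∩ Q ∩ U) ^ t ≤ ediam U ^ t :=
        ENNReal.rpow_le_rpow (ediam_mono inter_subset_right) ht.le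
      rcases (G ∩ Q ∩ U).eq_empty_or_nonempty with he | ⟨x, hx⟩
      · rw [he]; simp
      have hdQ : ediam (G ∩ Q ∩ U) ≤ ENNReal.ofReal r₀ :=
        (ediam_mono (inter_subset_left.trans inter_subset_right)).trans hQ
      have hdtop : ediam (G ∩ Q ∩ U) ≠ ∞ := ne_top_of_le_ne_top ENNReal.ofReal_ne_top hdQ
      rcases eq_or_ne (ediam (G ∩ Q ∩ U)) 0 with h0 | h0
      · refine (hausdorffContent_le_ediam_rpow ht _).trans ?_
        rw [h0, ENNReal.zero_rpow_of_pos ht]; exact zero_le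
      set d := (ediam (G ∩ Q ∩ U)).toReal with hd
      have hdd : ENNReal.ofReal d = ediam (G ∩ Q ∩ U) := ENNReal.ofReal_toReal hdtop
      have hdpos : 0 < d := ENNReal.toReal_pos h0 hdtop
      have hdr : d ≤ r₀ := by
        rw [← ENNReal.ofReal_le_ofReal_iff hr₀.le, hdd]; exact hdQ
      have hsub : G ∩ Q ∩ U ⊆ A ∩ closedBall x d := by
        intro y hy
        refine ⟨hy.1.1.1, ?_⟩
        rw [mem_closedBall, ← ENNReal.ofReal_le_ofReal_iff hdpos.le, ← edist_dist, hdd]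
        exact edist_le_ediam_of_mem hy hx
      calc H (G ∩ Q ∩ U) ≤ H (A ∩ closedBall x d) := measure_mono hsub
        _ ≤ ENNReal.ofReal d ^ t / 2 := hx.1.1.2 d hdpos hdr
        _ ≤ ediam U ^ t / 2 := by rw [hdd]; gcongr
    by_contra hne
    have hlt : H (G ∩ Q) < 2 * H (G ∩ Q) := by
      rw [two_mul]; exact ENNReal.lt_add_right hfin hne
    obtain ⟨U, hU, hUs⟩ := exists_cover_of_hausdorffContent_lt ht hlt
    have : H (G ∩ Q) ≤ (∑' n, ediam (U n) ^ t) / 2 := by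
      calc H (G ∩ Q) ≤ H (⋃ n, G ∩ Q ∩ U n) := by
            apply measure_mono
            rw [← inter_iUnion]
            exact subset_inter Subset.rfl hU
        _ ≤ ∑' n, H (G ∩ Q ∩ U n) := measure_iUnion_le _
        _ ≤ ∑' n, ediam (U n) ^ t / 2 := ENNReal.tsum_le_tsum fun n => hpiece _
        _ = _ := by simp only [div_eq_mul_inv]; rw [ENNReal.tsum_mul_right]
    have h2 : (∑' n, ediam (U n) ^ t) / 2 < H (G ∩ Q) := by
      rw [ENNReal.div_lt_iff (by simp) (by simp), mul_comm]; exact hUs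
    exact absurd (this.trans_lt h2) (lt_irrefl _)
  rcases isEmpty_or_nonempty E with hE | hE
  · rw [Set.eq_empty_of_isEmpty G]; simp
  have hcov : G ⊆ ⋃ n, G ∩ closedBall (TopologicalSpace.denseSeq E n) (r₀ / 2) := by
    intro x hx
    obtain ⟨n, hn⟩ := (TopologicalSpace.denseRange_denseSeq E).exists_dist_lt x
      (half_pos hr₀)
    exact mem_iUnion.2 ⟨n, hx, mem_closedBall.2 hn.le⟩
  refine le_antisymm ((measure_mono hcov).trans ((measure_iUnion_le _).trans ?_)) zero_le
  rw [ENNReal.tsum_eq_zero.2 fun n => key _ ?_]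
  exact (ediam_closedBall_le_ofReal _ _).trans_eq (by congr 1; ring)

/-- The set of points of `A` where the upper `t`-density of the content of `A` is at most `1/2`. -/
def sparsePoints {t : ℝ} (ht : 0 < t) (A : Set E) : Set E :=
  {x ∈ A | ∃ r₀ : ℝ, 0 < r₀ ∧ ∀ r : ℝ, 0 < r → r ≤ r₀ →
      hausdorffContent E t ht (A ∩ closedBall x r) ≤ ENNReal.ofReal r ^ t / 2}

lemma hausdorffContent_sparsePoints [TopologicalSpace.SeparableSpace E] {t : ℝ} (ht : 0 < t)
    (A : Set E) : hausdorffContent E t ht (sparsePoints ht A) = 0 := by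
  have hsub : sparsePoints ht A ⊆ ⋃ n : ℕ, {x ∈ A | ∀ r : ℝ, 0 < r → r ≤ 1 / ((n : ℝ) + 1) →
      hausdorffContent E t ht (A ∩ closedBall x r) ≤ ENNReal.ofReal r ^ t / 2} := by
    rintro x ⟨hxA, r₀, hr₀, h⟩
    obtain ⟨n, hn⟩ := exists_nat_one_div_lt hr₀
    exact mem_iUnion.2 ⟨n, hxA, fun r h1 h2 => h r h1 (h2.trans hn.le)⟩
  refine le_antisymm ((measure_mono hsub).trans ((measure_iUnion_le _).trans ?_)) zero_le
  rw [ENNReal.tsum_eq_zero.2 fun n => hausdorffContent_sparse_eq_zero ht A (by positivity)]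

/-- The exceptional set of a parametrization `f` : sparse points of images of cylinders. -/
def exceptionalSet {t : ℝ} (ht : 0 < t) (f : (ℕ → ℕ) → E) : Set E :=
  ⋃ p : Σ k : ℕ, Fin k → ℕ, sparsePoints ht (f '' {y | ∀ i : Fin p.1, y i = p.2 i})

lemma hausdorffContent_exceptionalSet [TopologicalSpace.SeparableSpace E] {t : ℝ} (ht : 0 < t)
    (f : (ℕ → ℕ) → E) : hausdorffContent E t ht (exceptionalSet ht f) = 0 := by
  refine le_antisymm ((measure_iUnion_le _).trans ?_) zero_le
  rw [ENNReal.tsum_eq_zero.2 fun p => hausdorffContent_sparsePoints ht _]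

/-- The part of the image of the `k`-cylinder at `z` in the ball of radius `r` around `f z`, with the
exceptional set removed. -/
def nodePiece {t : ℝ} (ht : 0 < t) (f : (ℕ → ℕ) → E) (k : ℕ) (z : ℕ → ℕ) (r : ℝ) : Set E :=
  (f '' PiNat.cylinder z k ∩ closedBall (f z) r) \ exceptionalSet ht f

/-- A node of level `k` has large content at its own scale. -/
def IsGoodNode {t : ℝ} (ht : 0 < t) (f : (ℕ → ℕ) → E) (k : ℕ) (z : ℕ → ℕ) (r : ℝ) : Prop :=
  0 < r ∧ ENNReal.ofReal r ^ t / 2 < hausdorffContent E t ht (nodePiece ht f k z r)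

/-- The tree can be continued from any such point, at every level and at arbitrarily small scale.
Removing the exceptional set from a node costs no content, because that set is null. -/
lemma exists_isGoodNode_of_notMem_exceptionalSet [TopologicalSpace.SeparableSpace E] {t : ℝ}
    (ht : 0 < t) (f : (ℕ → ℕ) → E) (k : ℕ) (z : ℕ → ℕ) (hz : f z ∉ exceptionalSet ht f)
    {r₀ : ℝ} (hr₀ : 0 < r₀) : ∃ r ≤ r₀, IsGoodNode ht f k z r := by
  have hcyl : {y : ℕ → ℕ | ∀ i : Fin k, y i = z i} = PiNat.cylinder z k := by
    ext y; simp [PiNat.cylinder, Fin.forall_iff]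
  have h1 : f z ∉ sparsePoints ht (f '' PiNat.cylinder z k) := by
    intro h
    exact hz (mem_iUnion.2 ⟨⟨k, fun i => z i⟩, by rwa [hcyl]⟩)
  simp only [sparsePoints, mem_ofPred_eq, not_and, not_exists] at h1
  have h2 := h1 ⟨z, PiNat.self_mem_cylinder z k, rfl⟩ r₀ hr₀
  push Not at h2
  obtain ⟨r, hr, hrr, hlt⟩ := h2
  refine ⟨r, hrr, hr, hlt.trans_le ?_⟩
  refine (measure_le_inter_add_sdiff _ _ (exceptionalSet ht f)).trans ?_
  rw [measure_mono_null inter_subset_right (hausdorffContent_exceptionalSet ht f), zero_add]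
  rfl

end Content

/-! ### Greedy weights under a monotone family of constraints. -/

section Greedy

/-- The greedy maximal weight subject to `∑ i ∈ S, ν i ≤ g S` for all finite `S`. -/
def greedyWeight (g : Finset ℕ → ℝ) (n : ℕ) : ℝ :=
  (Finset.range n).powerset.inf' (Finset.powerset_nonempty _) fun T =>
    g (insert n T) - ∑ i : Fin n, if (i : ℕ) ∈ T then greedyWeight g i else 0
termination_by n
decreasing_by exact i.2

lemma greedyWeight_eq (g : Finset ℕ → ℝ) (n : ℕ) :
    greedyWeight g n = (Finset.range n).powerset.inf' (Finset.powerset_nonempty _) fun T =>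
      g (insert n T) - ∑ i ∈ T, greedyWeight g i := by
  rw [greedyWeight]
  refine Finset.inf'_congr _ rfl fun T hT => ?_
  congr 1
  rw [Fin.sum_univ_eq_sum_range (fun i => if i ∈ T then greedyWeight g i else 0) n,
    ← Finset.sum_filter, Finset.filter_mem_eq_inter,
    Finset.inter_eq_right.2 (Finset.mem_powerset.1 hT)]

/-- The constraint for `S` is enforced when its largest element receives its weight. -/
lemma sum_greedyWeight_le {g : Finset ℕ → ℝ} (h0 : g ∅ = 0) (S : Finset ℕ) :
    ∑ i ∈ S, greedyWeight g i ≤ g S := by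
  rcases S.eq_empty_or_nonempty with rfl | hS
  · simp [h0]
  set n := S.max' hS
  have hn : n ∈ S := S.max'_mem hS
  have hT : S.erase n ∈ (Finset.range n).powerset := by
    rw [Finset.mem_powerset]
    intro i hi
    rw [Finset.mem_range]
    exact lt_of_le_of_ne (S.le_max' i (Finset.mem_of_mem_erase hi)) (Finset.ne_of_mem_erase hi)
  have := Finset.inf'_le (fun T => g (insert n T) - ∑ i ∈ T, greedyWeight g i) hT
  rw [← greedyWeight_eq, Finset.insert_erase hn] at this
  rw [← Finset.add_sum_erase S _ hn]
  linarith

lemma greedyWeight_nonneg {g : Finset ℕ → ℝ} (h0 : g ∅ = 0) (hg : Monotone g) (n : ℕ) :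
    0 ≤ greedyWeight g n := by
  rw [greedyWeight_eq]
  refine Finset.le_inf' _ _ ?_
  intro T _
  have := sum_greedyWeight_le h0 T
  have := hg (Finset.subset_insert n T)
  linarith

/-- The minimum over finitely many `T` is attained: each index is blocked by a tight constraint. No
compactness argument is needed to obtain a saturated weight. -/
lemma exists_sum_greedyWeight_eq (g : Finset ℕ → ℝ) (n : ℕ) :
    ∃ S, n ∈ S ∧ ∑ i ∈ S, greedyWeight g i = g S := by
  obtain ⟨T, hT, h⟩ := Finset.exists_mem_eq_inf' (s := (Finset.range n).powerset)
    (Finset.powerset_nonempty _)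
    fun T => g (insert n T) - ∑ i ∈ T, greedyWeight g i
  rw [← greedyWeight_eq] at h
  have hn : n ∉ T := fun hn => by simpa using Finset.mem_powerset.1 hT hn
  refine ⟨insert n T, Finset.mem_insert_self _ _, ?_⟩
  rw [Finset.sum_insert hn, h]
  ring

lemma exists_saturated_weight {ι : Type*} [Countable ι] (g : Finset ι → ℝ) (h0 : g ∅ = 0)
    (hg : Monotone g) :
    ∃ ν : ι → ℝ, (∀ i, 0 ≤ ν i) ∧ (∀ S, ∑ i ∈ S, ν i ≤ g S) ∧
      ∀ i, ∃ S, i ∈ S ∧ ∑ j ∈ S, ν j = g S := by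
  classical
  obtain ⟨e, he⟩ := exists_injective_nat ι
  set g' : Finset ℕ → ℝ := fun S => g (S.preimage e he.injOn) with hg'
  have h0' : g' ∅ = 0 := by simp [hg', h0]
  have hmono : Monotone g' := fun S T h => hg (Finset.monotone_preimage he h)
  have hsub : ∀ S : Finset ι, (S.image e).preimage e he.injOn = S := by
    intro S; ext i; simp [he.eq_iff]
  refine ⟨fun i => greedyWeight g' (e i), fun i => greedyWeight_nonneg h0' hmono _,
    fun S => ?_, fun i => ?_⟩
  · have := sum_greedyWeight_le h0' (S.image e)
    rw [Finset.sum_image he.injOn] at this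
    simpa only [hg', hsub] using this
  · obtain ⟨S, hiS, hS⟩ := exists_sum_greedyWeight_eq g' (e i)
    refine ⟨S.preimage e he.injOn, by simpa using hiS, ?_⟩
    rw [Finset.sum_preimage e S he.injOn, hS]
    -- Numbers that code no index have weight zero, because their constraint is `g ∅ = 0`.
    intro x _ hx
    have h1 := sum_greedyWeight_le h0' {x}
    have h2 : ({x} : Finset ℕ).preimage e he.injOn = ∅ := by
      ext j
      simp only [Finset.mem_preimage, Finset.mem_singleton, Finset.notMem_empty, iff_false]
      rintro rfl
      exact hx ⟨j, rfl⟩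
    simp only [Finset.sum_singleton, hg', h2, h0] at h1
    exact le_antisymm h1 (greedyWeight_nonneg h0' hmono _)

end Greedy

/-! ### A discrete Frostman lemma for families of balls. -/

section Discrete

variable {E : Type*} [MetricSpace E]

/-- The size of a finite family of balls: diameter of the set of centres plus the largest radius. -/
def familySize {ι : Type*} (y : ι → E) (ρ : ι → NNReal) (S : Finset ι) : ℝ :=
  diam (y '' S) + (S.sup ρ : NNReal)

lemma familySize_nonneg {ι : Type*} (y : ι → E) (ρ : ι → NNReal) (S : Finset ι) :
    0 ≤ familySize y ρ S := add_nonneg diam_nonneg NNReal.zero_le_coe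

lemma familySize_mono {ι : Type*} (y : ι → E) (ρ : ι → NNReal) : Monotone (familySize y ρ) := by
  intro S T h
  refine add_le_add (diam_mono (image_mono (by exact_mod_cast h)) ?_) ?_
  · exact (T.finite_toSet.image y).isBounded
  · exact_mod_cast Finset.sup_mono h

/-- A countable family of balls whose enlargements cover `A` carries a
weight which is at most `t`-dimensional and has total mass comparable to the content of `A`. -/
lemma exists_frostman_weight {ι : Type*} [Countable ι] {t : ℝ} (ht : 0 < t) (y : ι → E)
    (ρ : ι → NNReal) (R : ℝ) (hR : ∀ S, familySize y ρ S ≤ R) {A : Set E}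
    (hA : A ⊆ ⋃ i, closedBall (y i) (15 * ρ i)) :
    ∃ ν : ι → ℝ, (∀ i, 0 ≤ ν i) ∧ (∀ S, ∑ i ∈ S, ν i ≤ familySize y ρ S ^ t) ∧
      hausdorffContent E t ht A ≤ ENNReal.ofReal (66 ^ t) * ∑' i, ENNReal.ofReal (ν i) := by
  set h := familySize y ρ with hh
  have hh0 : ∀ S, 0 ≤ h S := familySize_nonneg y ρ
  obtain ⟨ν, hν0, hνle, hνsat⟩ := exists_saturated_weight (fun S => h S ^ t)
    (by simp [hh, familySize, ht.ne']) (fun S T hST =>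
      Real.rpow_le_rpow (hh0 S) (familySize_mono y ρ hST) ht.le)
  refine ⟨ν, hν0, hνle, ?_⟩
  choose S hmem hsat using hνsat
  -- Vitali is applied to the tight index sets, not to the balls. Disjointness makes the sum of `h
  -- (S b) ^ t`, which equals the weight carried by the chosen sets, at most the total weight.
  obtain ⟨v, -, hdisj, hcov⟩ := Vitali.exists_disjoint_subfamily_covering_enlargement
    (fun i => (S i : Set ι)) univ (fun i => h (S i)) 2 (by norm_num) (fun i _ => hh0 _) R
    (fun i _ => hR _) (fun i _ => ⟨i, hmem i⟩)
  have hρ : ∀ T : Finset ι, ∀ i ∈ T, (ρ i : ℝ) ≤ h T := by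
    intro T i hi
    have h1 : ρ i ≤ T.sup ρ := Finset.le_sup hi
    have h2 : (ρ i : ℝ) ≤ (T.sup ρ : NNReal) := by exact_mod_cast h1
    have : 0 ≤ diam (y '' T) := diam_nonneg
    simp only [hh, familySize]; linarith
  have hd : ∀ T : Finset ι, ∀ i ∈ T, ∀ j ∈ T, dist (y i) (y j) ≤ h T := by
    intro T i hi j hj
    have h1 : dist (y i) (y j) ≤ diam (y '' T) :=
      dist_le_diam_of_mem (T.finite_toSet.image y).isBounded ⟨i, hi, rfl⟩ ⟨j, hj, rfl⟩
    have : (0 : ℝ) ≤ (T.sup ρ : NNReal) := NNReal.zero_le_coe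
    simp only [hh, familySize]; linarith
  -- Here `33 = 2 * (15 + 1) + 1`: the distance to `y i` is at most `15 * h (S i)`, crossing `S i`
  -- costs `h (S i) ≤ 2 * h (S b)`, and crossing `S b` costs `h (S b)`. Diameters double this to
  -- `66`.
  have hcovA : A ⊆ ⋃ b : v, closedBall (y b) (33 * h (S b)) := by
    intro x hx
    obtain ⟨i, hi⟩ := mem_iUnion.1 (hA hx)
    obtain ⟨b, hb, ⟨j, hj1, hj2⟩, hle⟩ := hcov i (mem_univ i)
    refine mem_iUnion.2 ⟨⟨b, hb⟩, ?_⟩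
    rw [mem_closedBall] at hi ⊢
    have h1 := hd (S i) i (hmem i) j hj1
    have h2 := hd (S b) j hj2 b (hmem b)
    have h3 := hρ (S i) i (hmem i)
    have h4 := dist_triangle4 x (y i) (y j) (y b)
    linarith
  have hsum : ∑' b : v, ENNReal.ofReal (h (S b) ^ t) ≤ ∑' i, ENNReal.ofReal (ν i) := by
    have h1 : ∀ b : v, ENNReal.ofReal (h (S b) ^ t) = ∑' i : S b, ENNReal.ofReal (ν i) := by
      intro b
      rw [← hsat b, ENNReal.ofReal_sum_of_nonneg fun i _ => hν0 i]
      exact (Finset.tsum_subtype (S b) fun i => ENNReal.ofReal (ν i)).symm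
    simp_rw [h1]
    rw [← ENNReal.tsum_sigma' fun p : Σ b : v, S b => ENNReal.ofReal (ν p.2)]
    refine ENNReal.tsum_comp_le_tsum_of_injective (f := fun p : Σ b : v, S b => (p.2 : ι)) ?_ _
    rintro ⟨⟨b, hb⟩, ⟨i, hi⟩⟩ ⟨⟨c, hc⟩, ⟨j, hj⟩⟩ (rfl : i = j)
    have : b = c := by
      by_contra hne
      exact Set.disjoint_left.1 (hdisj hb hc hne) hi hj
    subst this
    rfl
  calc hausdorffContent E t ht A
      ≤ ∑' b : v, hausdorffContent E t ht (closedBall (y b) (33 * h (S b))) :=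
        (measure_mono hcovA).trans (measure_iUnion_le _)
    _ ≤ ∑' b : v, ENNReal.ofReal (66 ^ t) * ENNReal.ofReal (h (S b) ^ t) := by
        refine ENNReal.tsum_le_tsum fun b => (hausdorffContent_le_ediam_rpow ht _).trans ?_
        refine (ENNReal.rpow_le_rpow (ediam_closedBall_le_ofReal _ _) ht.le).trans_eq ?_
        rw [ENNReal.ofReal_rpow_of_nonneg (by linarith [hh0 (S b)]) ht.le,
          ← ENNReal.ofReal_mul (by positivity), ← Real.mul_rpow (by norm_num) (hh0 _)]
        congr 2
        ring
    _ = ENNReal.ofReal (66 ^ t) * ∑' b : v, ENNReal.ofReal (h (S b) ^ t) := ENNReal.tsum_mul_left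
    _ ≤ _ := by gcongr

end Discrete

/-! ### Potential estimate from a growth bound. -/

section Shells

/-- Decompose dyadically in `D`: where `D` is about `R / 2 ^ n` the integrand is about `(R / 2 ^ n)
^ (-s)` on mass at most `K * (R / 2 ^ n) ^ t`, giving a geometric series of ratio `2 ^ (-(t - s))`.
-/
lemma setLIntegral_rpow_neg_le_of_measure_le {Ω : Type*} [MeasurableSpace Ω] (m : Measure Ω)
    {D : Ω → ℝ} (hD : Measurable D) {B : Set Ω} (hB : MeasurableSet B) {R K s t : ℝ}
    (hR : 0 < R) (hK : 0 ≤ K) (hs : 0 ≤ s) (hst : s < t) (hDB : ∀ ω ∈ B, 0 < D ω ∧ D ω ≤ R)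
    (hm : ∀ ρ : ℝ, 0 < ρ → m (B ∩ {ω | D ω ≤ ρ}) ≤ ENNReal.ofReal (K * ρ ^ t)) :
    ∫⁻ ω in B, ENNReal.ofReal (D ω ^ (-s)) ∂m ≤
      ENNReal.ofReal (2 ^ s * (1 - 2 ^ (-(t - s)))⁻¹ * K * R ^ (t - s)) := by
  set q : ℝ := 2 ^ (-(t - s)) with hq
  have hq0 : 0 < q := by positivity
  have hq1 : q < 1 := Real.rpow_lt_one_of_one_lt_of_neg (by norm_num) (by linarith)
  set ρ : ℕ → ℝ := fun n => R * 2⁻¹ ^ n with hρ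
  have hρ0 : ∀ n, 0 < ρ n := fun n => by positivity
  have hmeas : ∀ n, MeasurableSet {ω | D ω ≤ ρ n} := fun n => measurableSet_le hD measurable_const
  have hpt : ∀ ω ∈ B, ENNReal.ofReal (D ω ^ (-s)) ≤
      ∑' n, ({ω | D ω ≤ ρ n}.indicator fun _ => ENNReal.ofReal (ρ (n + 1) ^ (-s))) ω := by
    intro ω hω
    obtain ⟨h0, h1⟩ := hDB ω hω
    obtain ⟨n, hn1, hn2⟩ := exists_nat_pow_near_of_lt_one (x := D ω / R) (y := 2⁻¹)
      (by positivity) ((div_le_one hR).2 h1) (by norm_num) (by norm_num)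
    refine le_trans ?_ (ENNReal.le_tsum n)
    have hle : D ω ≤ ρ n := by rw [div_le_iff₀ hR] at hn2; simp only [hρ]; linarith
    have hlt : ρ (n + 1) ≤ D ω := by rw [lt_div_iff₀ hR] at hn1; simp only [hρ]; linarith
    rw [indicator_of_mem (by exact hle)]
    refine ENNReal.ofReal_le_ofReal ?_
    exact Real.rpow_le_rpow_of_nonpos (hρ0 _) hlt (by linarith)
  have hterm : ∀ n, ρ (n + 1) ^ (-s) * (K * ρ n ^ t) = 2 ^ s * K * R ^ (t - s) * q ^ n := by
    intro n
    have e1 : ρ n = R * 2 ^ (-(n : ℝ)) := by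
      simp only [hρ]; rw [Real.rpow_neg (by norm_num), Real.rpow_natCast, inv_pow]
    have e2 : ρ (n + 1) = R * 2 ^ (-(n : ℝ) - 1) := by
      simp only [hρ]
      rw [Real.rpow_sub (by norm_num), Real.rpow_neg (by norm_num), Real.rpow_natCast, pow_succ,
        inv_pow, Real.rpow_one]; ring
    have e3 : q ^ n = 2 ^ (-(t - s) * n) := by
      rw [hq, Real.rpow_mul (by norm_num), Real.rpow_natCast]
    rw [e1, e2, e3, Real.mul_rpow hR.le (by positivity), Real.mul_rpow hR.le (by positivity),
      ← Real.rpow_mul (by norm_num), ← Real.rpow_mul (by norm_num)]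
    calc R ^ (-s) * 2 ^ ((-(n : ℝ) - 1) * -s) * (K * (R ^ t * 2 ^ (-(n : ℝ) * t)))
        = K * (R ^ (-s) * R ^ t) * (2 ^ ((-(n : ℝ) - 1) * -s) * 2 ^ (-(n : ℝ) * t)) := by ring
      _ = K * R ^ (t - s) * (2 ^ s * 2 ^ (-(t - s) * (n : ℝ))) := by
          rw [← Real.rpow_add hR, ← Real.rpow_add (by norm_num), ← Real.rpow_add (by norm_num)]
          congr 2
          · congr 1; ring
          · ring
      _ = _ := by ring
  calc ∫⁻ ω in B, ENNReal.ofReal (D ω ^ (-s)) ∂m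
      ≤ ∫⁻ ω in B, ∑' n, ({ω | D ω ≤ ρ n}.indicator
          fun _ => ENNReal.ofReal (ρ (n + 1) ^ (-s))) ω ∂m := setLIntegral_mono' hB hpt
    _ = ∑' n, ∫⁻ ω in B, ({ω | D ω ≤ ρ n}.indicator
          fun _ => ENNReal.ofReal (ρ (n + 1) ^ (-s))) ω ∂m :=
        lintegral_tsum fun n => (measurable_const.indicator (hmeas n)).aemeasurable
    _ = ∑' n, ENNReal.ofReal (ρ (n + 1) ^ (-s)) * m (B ∩ {ω | D ω ≤ ρ n}) := by
        congr 1 with n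
        rw [lintegral_indicator_const (hmeas n), Measure.restrict_apply (hmeas n), inter_comm]
    _ ≤ ∑' n, ENNReal.ofReal (2 ^ s * K * R ^ (t - s) * q ^ n) := by
        refine ENNReal.tsum_le_tsum fun n => ?_
        rw [← hterm, ENNReal.ofReal_mul (by have := hρ0 (n + 1); positivity)]
        gcongr
        exact hm _ (hρ0 n)
    _ = ENNReal.ofReal (∑' n, 2 ^ s * K * R ^ (t - s) * q ^ n) :=
        (ENNReal.ofReal_tsum_of_nonneg (fun n => by positivity)
          ((summable_geometric_of_lt_one hq0.le hq1).mul_left _)).symm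
    _ = _ := by
        rw [tsum_mul_left, tsum_geometric_of_lt_one hq0.le hq1]
        congr 1; ring

end Shells

/-! ### The random tree: nodes and the laws of their children. -/

/-- A node of the random tree: a parameter in Baire space and a radius. -/
structure TreeNode where
  seq : ℕ → ℕ
  rad : ℝ

/-- The discrete σ-algebra makes every function of a node measurable; child laws live on countable
sets. -/
instance : MeasurableSpace TreeNode := ⊤

instance : DiscreteMeasurableSpace TreeNode := ⟨fun _ => trivial⟩

instance : Inhabited TreeNode := ⟨⟨0, 0⟩⟩

section Children

variable {E : Type*} [MetricSpace E]

/-- `p` is a law for the children of the node `n` of level `k`, carried by the set `T`. -/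
structure IsChildLaw {t : ℝ} (ht : 0 < t) (f : (ℕ → ℕ) → E) (s θ K : ℝ) (k : ℕ) (n : TreeNode)
    (p : Measure TreeNode) (T : Set TreeNode) : Prop where
  isProbabilityMeasure : IsProbabilityMeasure p
  countable : T.Countable
  compl_eq_zero : p Tᶜ = 0
  mem_cylinder : ∀ a ∈ T, a.seq ∈ PiNat.cylinder n.seq k
  dist_le : ∀ a ∈ T, dist (f a.seq) (f n.seq) ≤ n.rad
  rad_le : ∀ a ∈ T, a.rad ≤ θ * n.rad
  isGoodNode : ∀ a ∈ T, IsGoodNode ht f (k + 1) a.seq a.rad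
  separated : ∀ a ∈ T, ∀ b ∈ T, a ≠ b → 3 * a.rad ≤ dist (f a.seq) (f b.seq)
  measure_singleton_le : ∀ a ∈ T, p {a} ≤ ENNReal.ofReal (K * (a.rad / n.rad) ^ t)
  potential_le : ∀ a ∈ T, ∫⁻ b in T \ {a}, ENNReal.ofReal (dist (f a.seq) (f b.seq) ^ (-s)) ∂p ≤
    ENNReal.ofReal (K * n.rad ^ (-s))

/-- Every point of a good node's piece is the centre of a good node of the next level with radius at
most `θ * r`. A Vitali subfamily of these is separated, its enlargements cover the piece, and the
normalized discrete Frostman weight is the law. It is essential that `K` is chosen before `θ`. -/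
lemma exists_isChildLaw [TopologicalSpace.SeparableSpace E] {t : ℝ} (ht : 0 < t)
    (f : (ℕ → ℕ) → E) {s : ℝ} (hs : 0 ≤ s) (hst : s < t) :
    ∃ K : ℝ, 0 < K ∧ ∀ θ : ℝ, 0 < θ → θ ≤ 1 → ∀ (k : ℕ) (n : TreeNode),
      IsGoodNode ht f k n.seq n.rad → ∃ p T, IsChildLaw ht f s θ K k n p T := by
  classical
  -- The `2` comes from the half in `IsGoodNode`, the `66 ^ t` from `exists_frostman_weight`.
  set K₀ : ℝ := 2 * 66 ^ t with hK₀
  set c : ℝ := 2 ^ s * (1 - 2 ^ (-(t - s)))⁻¹ with hc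
  have hq1 : (2 : ℝ) ^ (-(t - s)) < 1 :=
    Real.rpow_lt_one_of_one_lt_of_neg (by norm_num) (by linarith)
  have hcpos : 0 < c := mul_pos (by positivity) (inv_pos.2 (by linarith))
  refine ⟨max K₀ (c * (K₀ * 3 ^ t) * 2 ^ (t - s)), by positivity, ?_⟩
  rintro θ hθ hθ1 k n ⟨hr, hcont⟩
  set r := n.rad with hrdef
  set A := nodePiece ht f k n.seq r with hA
  have hchild : ∀ x : E, x ∈ A → ∃ a : TreeNode, a.seq ∈ PiNat.cylinder n.seq k ∧ f a.seq = x ∧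
      a.rad ≤ θ * r ∧ IsGoodNode ht f (k + 1) a.seq a.rad := by
    rintro x ⟨⟨⟨z, hz, rfl⟩, -⟩, hx⟩
    obtain ⟨ρ, h1, h2⟩ := exists_isGoodNode_of_notMem_exceptionalSet ht f (k + 1) z hx
      (mul_pos hθ hr)
    exact ⟨⟨z, ρ⟩, hz, rfl, h1, h2⟩
  choose! c' hc1 hc2 hc3 hc4 using hchild
  -- Tripled radii give the separation required of siblings; the fivefold enlargement then produces
  -- the factor `15`.
  obtain ⟨u, huA, hdisj, hcov⟩ := Vitali.exists_disjoint_subfamily_covering_enlargement_closedBall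
    A id (fun x => 3 * (c' x).rad) (3 * (θ * r)) (fun x hx => by linarith [hc3 x hx]) 5
    (by norm_num)
  have hradpos : ∀ x ∈ u, 0 < (c' x).rad := fun x hx => (hc4 x (huA hx)).1
  have hucount : u.Countable := hdisj.countable_of_nonempty_interior fun x hx =>
    ⟨x, ball_subset_interior_closedBall (mem_ball_self (by linarith [hradpos x hx]))⟩
  have : Countable u := hucount.to_subtype
  have hsep : ∀ x ∈ u, ∀ y ∈ u, x ≠ y → 3 * (c' x).rad ≤ dist x y := by
    intro x hx y hy hxy
    by_contra! hlt
    have hd : Disjoint (closedBall x (3 * (c' x).rad)) (closedBall y (3 * (c' y).rad)) :=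
      hdisj hx hy hxy
    refine hd.le_bot (show y ∈ _ from ⟨?_, ?_⟩)
    · rw [mem_closedBall, dist_comm]; exact hlt.le
    · exact mem_closedBall_self (by linarith [hradpos y hy])
  set ρ : u → NNReal := fun x => (c' x).rad.toNNReal with hρ
  have hρc : ∀ x : u, (ρ x : ℝ) = (c' x).rad := fun x => Real.coe_toNNReal _ (hradpos x x.2).le
  set y : u → E := fun x => x with hy
  have hAball : ∀ x ∈ A, dist x (f n.seq) ≤ r := fun x hx => hx.1.2
  have hsize : ∀ (S : Finset u) (M : ℝ) (w : E), 0 ≤ M →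
      (∀ x ∈ S, dist (x : E) w ≤ M ∧ (c' x).rad ≤ M) → familySize y ρ S ≤ 3 * M := by
    intro S M w hM h
    have h1 : diam (y '' S) ≤ 2 * M := by
      refine diam_le_of_forall_dist_le (by linarith) ?_
      rintro _ ⟨a, ha, rfl⟩ _ ⟨b, hb, rfl⟩
      have := dist_triangle_right (a : E) b w
      linarith [(h a ha).1, (h b hb).1]
    have h2 : ((S.sup ρ : NNReal) : ℝ) ≤ M := by
      have : S.sup ρ ≤ M.toNNReal := Finset.sup_le fun x hx => by
        exact Real.toNNReal_le_toNNReal (h x hx).2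
      calc ((S.sup ρ : NNReal) : ℝ) ≤ (M.toNNReal : ℝ) := by exact_mod_cast this
        _ = M := Real.coe_toNNReal _ hM
    simp only [familySize]; linarith
  have hθr : θ * r ≤ r := by nlinarith
  have hsizeR : ∀ S, familySize y ρ S ≤ 3 * r := fun S => hsize S r (f n.seq) hr.le fun x _ =>
    ⟨hAball x (huA x.2), (hc3 x (huA x.2)).trans hθr⟩
  obtain ⟨ν, hν0, hνle, hνcont⟩ := exists_frostman_weight ht y ρ (3 * r) hsizeR (A := A) (by
    intro x hx
    obtain ⟨b, hb, hsub⟩ := hcov x hx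
    refine mem_iUnion.2 ⟨⟨b, hb⟩, ?_⟩
    have := hsub (mem_closedBall_self (by linarith [(hc4 x hx).1]))
    rw [hρc]
    rw [mem_closedBall] at this ⊢
    simp only [id] at this
    simp only [hy]
    linarith)
  set W := ∑' i, ENNReal.ofReal (ν i) with hW
  have hWle : W ≤ ENNReal.ofReal ((3 * r) ^ t) := by
    refine ENNReal.summable.tsum_le_of_sum_le fun S => ?_
    rw [← ENNReal.ofReal_sum_of_nonneg fun i _ => hν0 i]
    exact ENNReal.ofReal_le_ofReal ((hνle S).trans
      (Real.rpow_le_rpow (familySize_nonneg y ρ S) (hsizeR S) ht.le))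
  have hWtop : W ≠ ∞ := ne_top_of_le_ne_top ENNReal.ofReal_ne_top hWle
  have hWge : ENNReal.ofReal (r ^ t / K₀) ≤ W := by
    have h1 := hcont.le.trans hνcont
    have h2 : ENNReal.ofReal (r ^ t / K₀) =
        (ENNReal.ofReal (66 ^ t))⁻¹ * (ENNReal.ofReal r ^ t / 2) := by
      rw [ENNReal.ofReal_rpow_of_nonneg hr.le ht.le, ← ENNReal.ofReal_inv_of_pos (by positivity),
        show (2 : ℝ≥0∞) = ENNReal.ofReal 2 by simp, ← ENNReal.ofReal_div_of_pos (by norm_num),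
        ← ENNReal.ofReal_mul (by positivity)]
      congr 1
      rw [hK₀]; field_simp
    rw [h2]
    calc _ ≤ (ENNReal.ofReal (66 ^ t))⁻¹ * (ENNReal.ofReal (66 ^ t) * W) := by gcongr
      _ = W := by
        rw [← mul_assoc, ENNReal.inv_mul_cancel (by positivity) ENNReal.ofReal_ne_top, one_mul]
  have hW0 : W ≠ 0 := by
    have : (0 : ℝ≥0∞) < ENNReal.ofReal (r ^ t / K₀) := by positivity
    exact (this.trans_le hWge).ne'
  have hWinv : W⁻¹ ≤ ENNReal.ofReal (K₀ / r ^ t) := by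
    rw [ENNReal.inv_le_iff_inv_le, ← ENNReal.ofReal_inv_of_pos (by positivity), inv_div]
    exact hWge
  set q : Measure TreeNode :=
    Measure.sum fun i : u => ENNReal.ofReal (ν i) • Measure.dirac (c' i) with hq
  have hqapply : ∀ B : Set TreeNode,
      q B = ∑' i : u, ENNReal.ofReal (ν i) * B.indicator 1 (c' i) := by
    intro B
    rw [hq, Measure.sum_apply _ (MeasurableSet.of_discrete)]
    simp
  have hqle : ∀ (B : Set TreeNode) (M : ℝ),
      (∀ S : Finset u, (∀ x ∈ S, c' x ∈ B) → familySize y ρ S ≤ M) →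
      q B ≤ ENNReal.ofReal (M ^ t) := by
    intro B M h
    rw [hqapply]
    refine ENNReal.summable.tsum_le_of_sum_le fun S => ?_
    calc ∑ i ∈ S, ENNReal.ofReal (ν i) * B.indicator 1 (c' i)
        = ∑ i ∈ S.filter fun i : u => c' i ∈ B, ENNReal.ofReal (ν i) := by
          rw [Finset.sum_filter]
          refine Finset.sum_congr rfl fun i _ => ?_
          by_cases hi : c' i ∈ B <;> simp [hi]
      _ = ENNReal.ofReal (∑ i ∈ S.filter fun i : u => c' i ∈ B, ν i) :=
          (ENNReal.ofReal_sum_of_nonneg fun i _ => hν0 i).symm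
      _ ≤ _ := ENNReal.ofReal_le_ofReal ((hνle _).trans (Real.rpow_le_rpow
          (familySize_nonneg y ρ _) (h _ fun x hx => (Finset.mem_filter.1 hx).2) ht.le))
  set p : Measure TreeNode := W⁻¹ • q with hp
  set T : Set TreeNode := range fun i : u => c' i with hT
  have hple : ∀ (B : Set TreeNode) (M : ℝ), 0 ≤ M →
      (∀ S : Finset u, (∀ x ∈ S, c' x ∈ B) → familySize y ρ S ≤ M) →
      p B ≤ ENNReal.ofReal (K₀ * (M / r) ^ t) := by
    intro B M hM h
    calc p B = W⁻¹ * q B := by simp [hp]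
      _ ≤ ENNReal.ofReal (K₀ / r ^ t) * ENNReal.ofReal (M ^ t) := by
          gcongr
          exact hqle B M h
      _ = _ := by
          rw [← ENNReal.ofReal_mul (by positivity), Real.div_rpow hM hr.le]
          congr 1; ring
  refine ⟨p, T, ?_, countable_range _, ?_, ?_, ?_, ?_, ?_, ?_, ?_, ?_⟩
  · constructor
    simp only [hp, Measure.smul_apply, smul_eq_mul]
    rw [hqapply]
    simp only [indicator_univ, Pi.one_apply, mul_one]
    exact ENNReal.inv_mul_cancel hW0 hWtop
  · simp only [hp, Measure.smul_apply, smul_eq_mul]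
    rw [hqapply]
    simp [hT]
  · rintro _ ⟨i, rfl⟩; exact hc1 i (huA i.2)
  · rintro _ ⟨i, rfl⟩
    simp only [hc2 i (huA i.2)]
    exact hAball i (huA i.2)
  · rintro _ ⟨i, rfl⟩; exact hc3 i (huA i.2)
  · rintro _ ⟨i, rfl⟩; exact hc4 i (huA i.2)
  · rintro _ ⟨i, rfl⟩ _ ⟨j, rfl⟩ hij
    simp only [hc2 i (huA i.2), hc2 j (huA j.2)]
    exact hsep i i.2 j j.2 fun h => hij (by simp only [h])
  · rintro _ ⟨i, rfl⟩
    have hi := hradpos i i.2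
    refine (hple {c' i} (c' i).rad hi.le fun S hS => ?_).trans
      (ENNReal.ofReal_le_ofReal (by gcongr; exact le_max_left _ _))
    have hSi : ∀ x ∈ S, x = i := by
      intro x hx
      have h1 : c' x = c' i := hS x hx
      refine Subtype.ext ?_
      rw [← hc2 x (huA x.2), ← hc2 i (huA i.2), h1]
    have h1 : diam (y '' S) ≤ 0 := by
      refine diam_le_of_forall_dist_le le_rfl ?_
      rintro _ ⟨a, ha, rfl⟩ _ ⟨b, hb, rfl⟩
      rw [hSi a ha, hSi b hb, dist_self]
    have h2 : S.sup ρ ≤ ρ i := Finset.sup_le fun x hx => by rw [hSi x hx]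
    have h3 : ((S.sup ρ : NNReal) : ℝ) ≤ (ρ i : ℝ) := by exact_mod_cast h2
    rw [hρc] at h3
    simp only [familySize]; linarith
  · rintro _ ⟨i, rfl⟩
    -- Centres lie within `r` of the parent, so distances are at most `2 * r`. A sibling at distance
    -- at most `δ` has radius at most `δ` by separation, so such siblings form a family of size at
    -- most `3 * δ`. The node itself is excluded, since its radius may exceed `δ`.
    have hbound := setLIntegral_rpow_neg_le_of_measure_le p
      (D := fun b => dist (f (c' i).seq) (f b.seq)) Measurable.of_discrete
      (B := T \ {c' i}) MeasurableSet.of_discrete (R := 2 * r) (K := K₀ * (3 / r) ^ t)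
      (s := s) (t := t) (by positivity) (by positivity) hs hst ?_ ?_
    · refine hbound.trans (ENNReal.ofReal_le_ofReal ?_)
      have e : c * (K₀ * (3 / r) ^ t) * (2 * r) ^ (t - s) =
          c * (K₀ * 3 ^ t) * 2 ^ (t - s) * r ^ (-s) := by
        rw [Real.div_rpow (by norm_num) hr.le, Real.mul_rpow (by norm_num) hr.le,
          sub_eq_add_neg t s, Real.rpow_add hr]
        have : r ^ t ≠ 0 := (Real.rpow_pos_of_pos hr t).ne'
        field_simp
      rw [e]
      gcongr
      exact le_max_right _ _
    · rintro _ ⟨⟨j, rfl⟩, hj⟩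
      simp only [hc2 i (huA i.2), hc2 j (huA j.2)]
      have hne : (i : E) ≠ j := fun h => hj (by
        rw [mem_singleton_iff]; simp only [h])
      refine ⟨dist_pos.2 hne, ?_⟩
      have := dist_triangle_right (i : E) j (f n.seq)
      linarith [hAball i (huA i.2), hAball j (huA j.2)]
    · intro δ hδ
      refine (hple _ (3 * δ) (by positivity) fun S hS => ?_).trans_eq ?_
      · refine hsize S δ i hδ.le fun x hx => ?_
        obtain ⟨⟨-, h1⟩, h2⟩ := hS x hx
        have h2' : dist (i : E) x ≤ δ := by
          simpa only [hc2 i (huA i.2), hc2 x (huA x.2), mem_ofPred_eq] using h2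
        have hne : (x : E) ≠ i := fun h => h1 (by rw [mem_singleton_iff, h])
        have h3 := hsep x x.2 i i.2 hne
        rw [dist_comm] at h2'
        exact ⟨h2', by linarith [hradpos x x.2]⟩
      · rw [mul_assoc K₀, ← Real.mul_rpow (by positivity) hδ.le]
        congr 3; ring

end Children

/-! ### Markov chains with prescribed transitions. -/

section Chain

lemma measurableSet_eval_eq {ι N : Type*} [MeasurableSpace N] [DiscreteMeasurableSpace N] (i : ι)
    (a : N) : MeasurableSet {ω : ι → N | ω i = a} := by
  have h : {ω : ι → N | ω i = a} = (fun ω => ω i) ⁻¹' {a} := by ext; simp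
  rw [h]
  exact measurable_pi_apply i MeasurableSet.of_discrete

/-- The law `Q` on paths has transition laws `M`. -/
def IsMarkovPathLaw {N : Type*} [MeasurableSpace N] (M : ℕ → N → Measure N)
    (Q : Measure (ℕ → N)) : Prop :=
  ∀ (k : ℕ) (a : N) (B : Set ((i : Finset.Iic k) → N)) (F : N → ℝ≥0∞), MeasurableSet B →
    (∀ h ∈ B, h ⟨k, by simp⟩ = a) →
    ∫⁻ ω in {ω | Preorder.frestrictLe k ω ∈ B}, F (ω (k + 1)) ∂Q =
      Q {ω | Preorder.frestrictLe k ω ∈ B} * ∫⁻ b, F b ∂(M k a)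

open ProbabilityTheory in
/-- Existence of a Markov chain with given root and transition laws. -/
lemma exists_markovChain {N : Type*} [MeasurableSpace N] [DiscreteMeasurableSpace N] (a₀ : N)
    (M : ℕ → N → Measure N) [∀ k a, IsProbabilityMeasure (M k a)] :
    ∃ Q : Measure (ℕ → N), IsProbabilityMeasure Q ∧ (∀ᵐ ω ∂Q, ω 0 = a₀) ∧
      IsMarkovPathLaw M Q := by
  let κ : (n : ℕ) → Kernel ((i : Finset.Iic n) → N) N := fun n =>
    ⟨fun h => M n (h ⟨n, by simp⟩), (Measurable.of_discrete (f := M n)).comp (measurable_pi_apply _)⟩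
  have hκ : ∀ n, IsMarkovKernel (κ n) := fun n => ⟨fun h => by
    change IsProbabilityMeasure (M n _); infer_instance⟩
  -- This is the Ionescu-Tulcea measure started from a point mass at the root.
  refine ⟨Kernel.trajMeasure (X := fun _ => N) (Measure.dirac a₀) κ, inferInstance, ?_, ?_⟩
  · have hfr : Measurable (Preorder.frestrictLe (π := fun _ : ℕ => N) 0) := by fun_prop
    have hae : ∀ᵐ h ∂((Kernel.trajMeasure (X := fun _ => N) (Measure.dirac a₀) κ).map
        (Preorder.frestrictLe 0)), h ⟨0, by simp⟩ = a₀ := by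
      have hd : Measure.map (MeasurableEquiv.piUnique fun _ : Finset.Iic 0 => N).symm
          (Measure.dirac a₀) = Measure.dirac ((MeasurableEquiv.piUnique _).symm a₀) :=
        Measure.map_dirac' (MeasurableEquiv.measurable _) _
      rw [Kernel.trajMeasure]
      erw [hd]
      rw [Measure.dirac_bind (Kernel.measurable _), Kernel.traj_map_frestrictLe_apply,
        Kernel.partialTraj_self, Kernel.id_apply]
      rw [ae_dirac_iff (measurableSet_eval_eq _ _)]
      rfl
    exact ae_of_ae_map hfr.aemeasurable hae
  · intro k a B F hB hBa
    set Q := Kernel.trajMeasure (X := fun _ => N) (Measure.dirac a₀) κ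
    have hfr : Measurable (Preorder.frestrictLe (π := fun _ : ℕ => N) k) := by fun_prop
    have hF : Measurable F := Measurable.of_discrete
    have hB' : MeasurableSet {ω : ℕ → N | Preorder.frestrictLe k ω ∈ B} := hfr hB
    have key := Kernel.map_frestrictLe_trajMeasure_compProd_eq_map_trajMeasure
      (X := fun _ => N) (μ₀ := Measure.dirac a₀) (κ := κ) (a := k)
    have hmeas : Measurable fun p : ((i : Finset.Iic k) → N) × N =>
        B.indicator 1 p.1 * F p.2 := 
      ((measurable_one.indicator hB).comp measurable_fst).mul (hF.comp measurable_snd)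
    calc ∫⁻ ω in {ω | Preorder.frestrictLe k ω ∈ B}, F (ω (k + 1)) ∂Q
        = ∫⁻ ω, B.indicator 1 (Preorder.frestrictLe k ω) * F (ω (k + 1)) ∂Q := by
          rw [← lintegral_indicator hB']
          congr 1 with ω
          by_cases h : Preorder.frestrictLe k ω ∈ B <;> simp [indicator, h]
      _ = ∫⁻ p, B.indicator 1 p.1 * F p.2
            ∂(Q.map fun x => (Preorder.frestrictLe k x, x (k + 1))) := by
          rw [lintegral_map hmeas (by fun_prop)]
      _ = ∫⁻ h, ∫⁻ b, B.indicator 1 h * F b ∂(κ k h) ∂(Q.map (Preorder.frestrictLe k)) := by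
          rw [← key, Measure.lintegral_compProd hmeas]
      _ = ∫⁻ h, B.indicator (fun _ => ∫⁻ b, F b ∂(M k a)) h
            ∂(Q.map (Preorder.frestrictLe k)) := by
          congr 1 with h
          rw [lintegral_const_mul _ hF]
          by_cases hh : h ∈ B
          · have : κ k h = M k a := by rw [← hBa h hh]; rfl
            simp [hh, this]
          · simp [hh]
      _ = _ := by
          rw [lintegral_indicator_const hB, Measure.map_apply hfr hB, mul_comm]
          rfl

end Chain

/-! ### Geometry of tree paths and of their limits. -/

section Paths

variable {E : Type*} [MetricSpace E] {t : ℝ} {ht : 0 < t} {f : (ℕ → ℕ) → E} {s θ K : ℝ}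
  {M : ℕ → TreeNode → Measure TreeNode} {T : ℕ → TreeNode → Set TreeNode} {a₀ : TreeNode}

/-- The paths of the tree with root `a₀` and children sets `T`. -/
def treePaths (T : ℕ → TreeNode → Set TreeNode) (a₀ : TreeNode) : Set (ℕ → TreeNode) :=
  {ω | ω 0 = a₀ ∧ ∀ k, ω (k + 1) ∈ T k (ω k)}

/-- The point of Baire space determined by a path. -/
def pathLimit (ω : ℕ → TreeNode) (i : ℕ) : ℕ := (ω (i + 1)).seq i

lemma measurable_pathLimit : Measurable pathLimit :=
  measurable_pi_iff.2 fun i =>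
    (Measurable.of_discrete (f := fun a : TreeNode => a.seq i)).comp (measurable_pi_apply _)

/-- The family `M`, `T` provides child laws for all good nodes. -/
def IsTreeLaw (ht : 0 < t) (f : (ℕ → ℕ) → E) (s θ K : ℝ)
    (M : ℕ → TreeNode → Measure TreeNode) (T : ℕ → TreeNode → Set TreeNode) : Prop :=
  ∀ k n, IsGoodNode ht f k n.seq n.rad → IsChildLaw ht f s θ K k n (M k n) (T k n)

lemma isGoodNode_of_mem_treePaths (hM : IsTreeLaw ht f s θ K M T)
    (h₀ : IsGoodNode ht f 0 a₀.seq a₀.rad)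
    {ω : ℕ → TreeNode} (hω : ω ∈ treePaths T a₀) (k : ℕ) :
    IsGoodNode ht f k (ω k).seq (ω k).rad := by
  induction k with
  | zero => rw [hω.1]; exact h₀
  | succ k ih => exact (hM k _ ih).isGoodNode _ (hω.2 k)

lemma isChildLaw_of_mem_treePaths (hM : IsTreeLaw ht f s θ K M T)
    (h₀ : IsGoodNode ht f 0 a₀.seq a₀.rad)
    {ω : ℕ → TreeNode} (hω : ω ∈ treePaths T a₀) (k : ℕ) :
    IsChildLaw ht f s θ K k (ω k) (M k (ω k)) (T k (ω k)) :=
  hM k _ (isGoodNode_of_mem_treePaths hM h₀ hω k)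

lemma rad_pos_of_mem_treePaths (hM : IsTreeLaw ht f s θ K M T)
    (h₀ : IsGoodNode ht f 0 a₀.seq a₀.rad)
    {ω : ℕ → TreeNode} (hω : ω ∈ treePaths T a₀) (k : ℕ) :
    0 < (ω k).rad := (isGoodNode_of_mem_treePaths hM h₀ hω k).1

lemma rad_le_of_mem_treePaths (hM : IsTreeLaw ht f s θ K M T)
    (h₀ : IsGoodNode ht f 0 a₀.seq a₀.rad)
    (hθ : 0 ≤ θ) {ω : ℕ → TreeNode} (hω : ω ∈ treePaths T a₀) (k : ℕ) :
    (ω k).rad ≤ θ ^ k * a₀.rad := by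
  induction k with
  | zero => simp [hω.1]
  | succ k ih =>
    refine ((isChildLaw_of_mem_treePaths hM h₀ hω k).rad_le _ (hω.2 k)).trans ?_
    rw [pow_succ']
    nlinarith

/-- Children of a level `k` node keep its first `k` coordinates, so coordinate `i` is frozen from
level `i + 1` on, where `pathLimit` reads it. -/
lemma seq_mem_cylinder_pathLimit (hM : IsTreeLaw ht f s θ K M T)
    (h₀ : IsGoodNode ht f 0 a₀.seq a₀.rad)
    {ω : ℕ → TreeNode} (hω : ω ∈ treePaths T a₀) (k : ℕ) :
    (ω k).seq ∈ PiNat.cylinder (pathLimit ω) k := by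
  intro i hi
  induction k, hi using Nat.le_induction with
  | base => rfl
  | succ k hk ih =>
    rw [← ih]
    exact (isChildLaw_of_mem_treePaths hM h₀ hω k).mem_cylinder _ (hω.2 k) i hk

/-- Each step moves by at most the current radius and radii shrink by `1 / 5`, so the total is at
most `1 / (1 - 1 / 5) = 5 / 4` radii. The limit is taken in Baire space and transported by
continuity of `f`. -/
lemma dist_pathLimit_le (hM : IsTreeLaw ht f s θ K M T)
    (h₀ : IsGoodNode ht f 0 a₀.seq a₀.rad)
    (hf : Continuous f) (hθ5 : θ ≤ 1 / 5) {ω : ℕ → TreeNode}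
    (hω : ω ∈ treePaths T a₀) (k : ℕ) :
    dist (f (ω k).seq) (f (pathLimit ω)) ≤ 5 / 4 * (ω k).rad := by
  have hfin : ∀ m k, dist (f (ω k).seq) (f (ω (k + m)).seq) ≤ 5 / 4 * (ω k).rad := by
    intro m
    induction m with
    | zero => intro k; simpa using (rad_pos_of_mem_treePaths hM h₀ hω k).le
    | succ m ih =>
      intro k
      have h1 := ih (k + 1)
      have hc := isChildLaw_of_mem_treePaths hM h₀ hω k
      have h2 := hc.dist_le _ (hω.2 k)
      have h3 := hc.rad_le _ (hω.2 k)
      have h4 := rad_pos_of_mem_treePaths hM h₀ hω k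
      rw [dist_comm] at h2
      have h5 := dist_triangle (f (ω k).seq) (f (ω (k + 1)).seq) (f (ω (k + 1 + m)).seq)
      rw [show k + (m + 1) = k + 1 + m by ring]
      nlinarith
  have hlim : Tendsto (fun j => (ω j).seq) atTop (𝓝 (pathLimit ω)) := by
    refine tendsto_pi_nhds.2 fun i => tendsto_const_nhds.congr' ?_
    filter_upwards [eventually_gt_atTop i] with j hj
    exact (seq_mem_cylinder_pathLimit hM h₀ hω j i hj).symm
  have hlim2 : Tendsto (fun m => (ω (k + m)).seq) atTop (𝓝 (pathLimit ω)) :=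
    hlim.comp (tendsto_atTop_mono (fun m => Nat.le_add_left m k) tendsto_id)
  exact le_of_tendsto (tendsto_const_nhds.dist ((hf.tendsto _).comp hlim2))
    (Eventually.of_forall fun m => hfin m k)

/-- Siblings at distance `D` have radii at most `D / 3`, so passing to the limits loses at most `2 *
(5 / 4) * (D / 3) = 5 * D / 6`. -/
lemma dist_le_dist_pathLimit (hM : IsTreeLaw ht f s θ K M T)
    (h₀ : IsGoodNode ht f 0 a₀.seq a₀.rad)
    (hf : Continuous f) (hθ5 : θ ≤ 1 / 5)
    {ω ω' : ℕ → TreeNode} (hω : ω ∈ treePaths T a₀) (hω' : ω' ∈ treePaths T a₀) (k : ℕ)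
    (hk : ω' k = ω k) (hne : ω' (k + 1) ≠ ω (k + 1)) :
    dist (f (ω (k + 1)).seq) (f (ω' (k + 1)).seq) ≤
      6 * dist (f (pathLimit ω)) (f (pathLimit ω')) := by
  have h1 := dist_pathLimit_le hM h₀ hf hθ5 hω (k + 1)
  have h2 := dist_pathLimit_le hM h₀ hf hθ5 hω' (k + 1)
  have hc := isChildLaw_of_mem_treePaths hM h₀ hω k
  have hm := hω.2 k
  have hm' := hω'.2 k
  rw [hk] at hm'
  have h3 := hc.separated _ hm _ hm' hne.symm
  have h4 := hc.separated _ hm' _ hm hne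
  rw [dist_comm] at h4
  have h5 := dist_triangle4 (f (ω (k + 1)).seq) (f (pathLimit ω)) (f (pathLimit ω'))
    (f (ω' (k + 1)).seq)
  rw [dist_comm (f (pathLimit ω')) (f (ω' (k + 1)).seq)] at h5
  linarith

end Paths

/-! ### Mass and potential of the path law. -/

section Measure

variable {E : Type*} [MetricSpace E] {t : ℝ} {ht : 0 < t} {f : (ℕ → ℕ) → E} {s θ K : ℝ}
  {M : ℕ → TreeNode → Measure TreeNode} {T : ℕ → TreeNode → Set TreeNode} {a₀ : TreeNode}

/-- The paths agreeing with `ω` up to time `k`. -/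
def agreeSet (ω : ℕ → TreeNode) (k : ℕ) : Set (ℕ → TreeNode) := {ω' | ∀ i ≤ k, ω' i = ω i}

lemma agreeSet_eq (ω : ℕ → TreeNode) (k : ℕ) : agreeSet ω k =
    {ω' | Preorder.frestrictLe (π := fun _ => TreeNode) k ω' ∈
      ({Preorder.frestrictLe k ω} : Set ((i : Finset.Iic k) → TreeNode))} := by
  ext ω'
  simp only [agreeSet, mem_ofPred_eq, mem_singleton_iff, funext_iff, Subtype.forall,
    Finset.mem_Iic, Preorder.frestrictLe_apply]

lemma measurableSet_agreeSet (ω : ℕ → TreeNode) (k : ℕ) : MeasurableSet (agreeSet ω k) := by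
  rw [agreeSet, ofPred_forall]
  refine MeasurableSet.iInter fun i => ?_
  rw [ofPred_forall]
  exact MeasurableSet.iInter fun _ => measurableSet_eval_eq _ _

variable {Q : Measure (ℕ → TreeNode)}

lemma setLIntegral_agreeSet
    (hQ : IsMarkovPathLaw M Q)
    (ω : ℕ → TreeNode) (k : ℕ) (F : TreeNode → ℝ≥0∞) :
    ∫⁻ ω' in agreeSet ω k, F (ω' (k + 1)) ∂Q = Q (agreeSet ω k) * ∫⁻ b, F b ∂(M k (ω k)) := by
  rw [agreeSet_eq]
  refine hQ k (ω k) _ F (measurableSet_singleton _) ?_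
  rintro h rfl
  rfl

lemma measure_agreeSet_succ
    (hQ : IsMarkovPathLaw M Q)
    (ω : ℕ → TreeNode) (k : ℕ) :
    Q (agreeSet ω (k + 1)) = Q (agreeSet ω k) * M k (ω k) {ω (k + 1)} := by
  have h := setLIntegral_agreeSet hQ ω k (indicator {ω (k + 1)} 1)
  rw [lintegral_indicator_one MeasurableSet.of_discrete] at h
  rw [← h, ← lintegral_indicator_one (measurableSet_agreeSet ω (k + 1)),
    ← lintegral_indicator (measurableSet_agreeSet ω k)]
  congr 1 with ω'
  have : ω' ∈ agreeSet ω (k + 1) ↔ ω' ∈ agreeSet ω k ∧ ω' (k + 1) = ω (k + 1) := by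
    simp only [agreeSet, mem_ofPred_eq, Nat.le_succ_iff]
    constructor
    · exact fun h => ⟨fun i hi => h i (Or.inl hi), h _ (Or.inr rfl)⟩
    · rintro ⟨h1, h2⟩ i (hi | rfl)
      exacts [h1 i hi, h2]
  by_cases h1 : ω' ∈ agreeSet ω k <;> by_cases h2 : ω' (k + 1) = ω (k + 1) <;>
    simp [indicator, this, h1, h2]

/-- There are uncountably many nodes, so null events cannot be discarded node by node. The induction
provides a countable set of good nodes carrying each generation. -/
lemma ae_mem_treePaths
    (hQ₀ : ∀ᵐ ω ∂Q, ω 0 = a₀) (hQ : IsMarkovPathLaw M Q)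
    (hM : IsTreeLaw ht f s θ K M T) (h₀ : IsGoodNode ht f 0 a₀.seq a₀.rad) :
    ∀ᵐ ω ∂Q, ω ∈ treePaths T a₀ := by
  have step : ∀ k a, IsGoodNode ht f k a.seq a.rad →
      ∀ᵐ ω ∂Q, ω k = a → ω (k + 1) ∈ T k a := by
    intro k a ha
    have hBk : MeasurableSet {h : (i : Finset.Iic k) → TreeNode | h ⟨k, by simp⟩ = a} :=
      measurableSet_eval_eq _ _
    have hmk : Measurable fun ω : ℕ → TreeNode =>
        (T k a)ᶜ.indicator (1 : TreeNode → ℝ≥0∞) (ω (k + 1)) :=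
      (Measurable.of_discrete (f := (T k a)ᶜ.indicator 1)).comp (measurable_pi_apply (k + 1))
    have h1 := hQ k a _ (indicator (T k a)ᶜ 1) hBk fun h hh => hh
    rw [lintegral_indicator_one MeasurableSet.of_discrete, (hM k a ha).compl_eq_zero, mul_zero,
      lintegral_eq_zero_iff hmk, EventuallyEq, ae_restrict_iff'] at h1
    · filter_upwards [h1] with ω hω hωk
      have := hω hωk
      by_contra hnot
      simp [hnot] at this
    · exact measurableSet_eval_eq _ _
  have key : ∀ k, ∃ C : Set TreeNode, C.Countable ∧ (∀ a ∈ C, IsGoodNode ht f k a.seq a.rad) ∧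
      (∀ᵐ ω ∂Q, ω k ∈ C) := by
    intro k
    induction k with
    | zero => exact ⟨{a₀}, countable_singleton _, by rintro _ rfl; exact h₀, hQ₀⟩
    | succ k ih =>
      obtain ⟨C, hC, hg, hae⟩ := ih
      refine ⟨⋃ a ∈ C, T k a, hC.biUnion fun a ha => (hM k a (hg a ha)).countable, ?_, ?_⟩
      · intro b hb
        obtain ⟨a, ha, hb⟩ := mem_iUnion₂.1 hb
        exact (hM k a (hg a ha)).isGoodNode b hb
      · filter_upwards [hae, (ae_ball_iff hC).2 fun a ha => step k a (hg a ha)] with ω h1 h2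
        exact mem_iUnion₂.2 ⟨ω k, h1, h2 _ h1 rfl⟩
  have hall : ∀ k, ∀ᵐ ω ∂Q, ω (k + 1) ∈ T k (ω k) := by
    intro k
    obtain ⟨C, hC, hg, hae⟩ := key k
    filter_upwards [hae, (ae_ball_iff hC).2 fun a ha => step k a (hg a ha)] with ω h1 h2
    exact h2 _ h1 rfl
  filter_upwards [hQ₀, ae_all_iff.2 hall] with ω h1 h2
  exact ⟨h1, h2⟩

lemma measure_agreeSet_le
    (hQ : IsMarkovPathLaw M Q) (hM : IsTreeLaw ht f s θ K M T)
    (h₀ : IsGoodNode ht f 0 a₀.seq a₀.rad)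
    [IsProbabilityMeasure Q] (hK : 0 < K) {ω : ℕ → TreeNode} (hω : ω ∈ treePaths T a₀) (k : ℕ) :
    Q (agreeSet ω k) ≤ ENNReal.ofReal (K ^ k * ((ω k).rad / a₀.rad) ^ t) := by
  have ha₀ : 0 < a₀.rad := h₀.1
  induction k with
  | zero => simpa [hω.1, div_self ha₀.ne'] using prob_le_one
  | succ k ih =>
    have h1 := rad_pos_of_mem_treePaths hM h₀ hω k
    have h2 := rad_pos_of_mem_treePaths hM h₀ hω (k + 1)
    rw [measure_agreeSet_succ hQ]
    refine (mul_le_mul' ih ((isChildLaw_of_mem_treePaths hM h₀ hω k).measure_singleton_le _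
      (hω.2 k))).trans_eq ?_
    rw [← ENNReal.ofReal_mul (by positivity)]
    congr 1
    rw [Real.div_rpow h1.le ha₀.le, Real.div_rpow h2.le h1.le, Real.div_rpow h2.le ha₀.le]
    have : (ω k).rad ^ t ≠ 0 := (Real.rpow_pos_of_pos h1 t).ne'
    field_simp
    ring

/-- The gap `t - s` pays for the factor `K` lost in each generation. -/
lemma pow_mul_rad_div_rpow_le
    (hM : IsTreeLaw ht f s θ K M T) (h₀ : IsGoodNode ht f 0 a₀.seq a₀.rad)
    (hK : 0 < K) (hθ : 0 < θ) (hst : s < t)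
    (hKθ : K * θ ^ (t - s) ≤ 1 / 2) {ω : ℕ → TreeNode} (hω : ω ∈ treePaths T a₀) (k : ℕ) :
    K ^ k * ((ω k).rad / a₀.rad) ^ (t - s) ≤ (1 / 2) ^ k := by
  have h1 := rad_pos_of_mem_treePaths hM h₀ hω k
  calc K ^ k * ((ω k).rad / a₀.rad) ^ (t - s) ≤ K ^ k * (θ ^ k) ^ (t - s) := by
        have : (ω k).rad / a₀.rad ≤ θ ^ k := by
          rw [div_le_iff₀ h₀.1]; exact rad_le_of_mem_treePaths hM h₀ hθ.le hω k
        have h2 : 0 ≤ (ω k).rad / a₀.rad := div_nonneg h1.le h₀.1.le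
        gcongr
    _ = (K * θ ^ (t - s)) ^ k := by
        rw [mul_pow, ← Real.rpow_natCast, ← Real.rpow_natCast, ← Real.rpow_natCast,
          ← Real.rpow_mul hθ.le, ← Real.rpow_mul hθ.le, mul_comm (k : ℝ)]
    _ ≤ _ := by gcongr

/-- Almost every path leaves `ω` at some first step `k + 1`. On that event the distance of the
limits is comparable to that of the siblings, and the Markov property gives the mass of the common
past times the potential of the child law. -/
lemma lintegral_potential_le
    (hQ₀ : ∀ᵐ ω ∂Q, ω 0 = a₀) (hQ : IsMarkovPathLaw M Q)
    (hM : IsTreeLaw ht f s θ K M T) (h₀ : IsGoodNode ht f 0 a₀.seq a₀.rad)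
    [IsProbabilityMeasure Q] (hf : Continuous f) (hK : 0 < K)
    (hθ : 0 < θ) (hθ5 : θ ≤ 1 / 5)
    (hs : 0 ≤ s) (hst : s < t) (hKθ : K * θ ^ (t - s) ≤ 1 / 2) {ω : ℕ → TreeNode}
    (hω : ω ∈ treePaths T a₀) :
    ∫⁻ ω', edist (f (pathLimit ω)) (f (pathLimit ω')) ^ (-s) ∂Q ≤
      ENNReal.ofReal (2 * (6 ^ s * K * a₀.rad ^ (-s))) := by
  have ha₀ : 0 < a₀.rad := h₀.1
  have hpaths := ae_mem_treePaths hQ₀ hQ hM h₀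
  set g : (ℕ → TreeNode) → ℝ≥0∞ := fun ω' =>
    edist (f (pathLimit ω)) (f (pathLimit ω')) ^ (-s) with hg
  set D : ℕ → Set (ℕ → TreeNode) := fun k => agreeSet ω k ∩ {ω' | ω' (k + 1) ≠ ω (k + 1)} with hD
  have hDm : ∀ k, MeasurableSet (D k) := fun k => (measurableSet_agreeSet ω k).inter
    (measurableSet_eval_eq _ _).compl
  have hpow := pow_mul_rad_div_rpow_le hM h₀ hK hθ hst hKθ hω
  have hrle : ∀ k, (ω k).rad / a₀.rad ≤ 1 := fun k => by
    rw [div_le_one ha₀]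
    refine (rad_le_of_mem_treePaths hM h₀ hθ.le hω k).trans ?_
    exact mul_le_of_le_one_left ha₀.le (pow_le_one₀ hθ.le (by linarith))
  -- The path `ω` itself must be null: for `s > 0` the kernel is infinite there.
  have hI : Q (⋂ k, agreeSet ω k) = 0 := by
    have hb : ∀ k, Q (⋂ k, agreeSet ω k) ≤ ENNReal.ofReal ((1 / 2) ^ k) := by
      intro k
      refine (measure_mono (iInter_subset _ k)).trans
        ((measure_agreeSet_le hQ hM h₀ hK hω k).trans (ENNReal.ofReal_le_ofReal ?_))
      refine le_trans ?_ (hpow k)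
      have h1 := rad_pos_of_mem_treePaths hM h₀ hω k
      gcongr K ^ k * ?_
      exact Real.rpow_le_rpow_of_exponent_ge (by positivity) (hrle k) (by linarith)
    have hlim : Tendsto (fun k : ℕ => ENNReal.ofReal ((1 / 2) ^ k)) atTop (𝓝 0) := by
      rw [← ENNReal.ofReal_zero]
      exact (ENNReal.continuous_ofReal.tendsto 0).comp
        (tendsto_pow_atTop_nhds_zero_of_lt_one (by norm_num) (by norm_num))
    exact le_antisymm (ge_of_tendsto' hlim hb) zero_le
  have hcover : ∀ᵐ ω' ∂Q, ω' ∈ (⋂ k, agreeSet ω k) ∪ ⋃ k, D k := by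
    filter_upwards [hQ₀] with ω' h0
    by_cases h : ∀ k, ω' k = ω k
    · exact Or.inl (mem_iInter.2 fun k i _ => h i)
    · right
      push Not at h
      classical
      have hne : Nat.find h ≠ 0 := fun h1 => by
        have := Nat.find_spec h
        rw [h1, h0, hω.1] at this
        exact this rfl
      obtain ⟨k, hk⟩ := Nat.exists_eq_succ_of_ne_zero hne
      refine mem_iUnion.2 ⟨k, fun i hi => ?_, ?_⟩
      · by_contra hne'
        have := Nat.find_min' h hne'
        omega
      · have := Nat.find_spec h
        rwa [hk] at this
  have hpiece : ∀ k, ∫⁻ ω' in D k, g ω' ∂Q ≤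
      ENNReal.ofReal (6 ^ s * K * a₀.rad ^ (-s) * (1 / 2) ^ k) := by
    intro k
    have hrk := rad_pos_of_mem_treePaths hM h₀ hω k
    have hlaw := isChildLaw_of_mem_treePaths hM h₀ hω k
    set F : TreeNode → ℝ≥0∞ := (T k (ω k) \ {ω (k + 1)}).indicator fun b =>
      ENNReal.ofReal (6 ^ s) * ENNReal.ofReal (dist (f (ω (k + 1)).seq) (f b.seq) ^ (-s)) with hF
    calc ∫⁻ ω' in D k, g ω' ∂Q = ∫⁻ ω', (D k).indicator g ω' ∂Q :=
          (lintegral_indicator (hDm k) _).symm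
      _ ≤ ∫⁻ ω', (agreeSet ω k).indicator (fun ω' => F (ω' (k + 1))) ω' ∂Q := by
          refine lintegral_mono_ae ?_
          filter_upwards [hpaths] with ω' hω'
          by_cases hmem : ω' ∈ D k
          swap
          · simp [hmem]
          have hk : ω' k = ω k := hmem.1 k le_rfl
          have hbT : ω' (k + 1) ∈ T k (ω k) := hk ▸ hω'.2 k
          have hd1 := dist_le_dist_pathLimit hM h₀ hf hθ5 hω hω' k hk hmem.2
          have hd2 := hlaw.separated _ (hω.2 k) _ hbT (Ne.symm hmem.2)
          have hd3 := rad_pos_of_mem_treePaths hM h₀ hω (k + 1)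
          set d := dist (f (ω (k + 1)).seq) (f (ω' (k + 1)).seq) with hd
          have hd0 : 0 < d := by linarith
          have hdl : 0 < dist (f (pathLimit ω)) (f (pathLimit ω')) := by linarith
          rw [indicator_of_mem hmem, indicator_of_mem hmem.1]
          simp only [hF]
          rw [indicator_of_mem (show ω' (k + 1) ∈ T k (ω k) \ {ω (k + 1)} from ⟨hbT, hmem.2⟩)]
          simp only [hg]
          rw [edist_dist, ENNReal.ofReal_rpow_of_pos hdl, ← ENNReal.ofReal_mul (by positivity)]
          refine ENNReal.ofReal_le_ofReal ?_
          calc dist (f (pathLimit ω)) (f (pathLimit ω')) ^ (-s) ≤ (6⁻¹ * d) ^ (-s) :=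
                Real.rpow_le_rpow_of_nonpos (by positivity) (by linarith) (by linarith)
            _ = 6 ^ s * d ^ (-s) := by
                rw [Real.mul_rpow (by norm_num) hd0.le, Real.inv_rpow (by norm_num),
                  Real.rpow_neg (by norm_num), inv_inv]
      _ = Q (agreeSet ω k) * ∫⁻ b, F b ∂(M k (ω k)) := by
          rw [lintegral_indicator (measurableSet_agreeSet ω k), setLIntegral_agreeSet hQ]
      _ ≤ ENNReal.ofReal (K ^ k * ((ω k).rad / a₀.rad) ^ t) *
            (ENNReal.ofReal (6 ^ s) * ENNReal.ofReal (K * (ω k).rad ^ (-s))) := by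
          refine mul_le_mul' (measure_agreeSet_le hQ hM h₀ hK hω k) ?_
          rw [hF, lintegral_indicator MeasurableSet.of_discrete,
            lintegral_const_mul _ Measurable.of_discrete]
          gcongr
          exact hlaw.potential_le _ (hω.2 k)
      _ ≤ _ := by
          rw [← ENNReal.ofReal_mul (by positivity), ← ENNReal.ofReal_mul (by positivity)]
          refine ENNReal.ofReal_le_ofReal ?_
          calc K ^ k * ((ω k).rad / a₀.rad) ^ t * (6 ^ s * (K * (ω k).rad ^ (-s)))
              = 6 ^ s * K * a₀.rad ^ (-s) * (K ^ k * ((ω k).rad / a₀.rad) ^ (t - s)) := by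
                rw [sub_eq_add_neg, Real.rpow_add (by positivity),
                  Real.div_rpow hrk.le ha₀.le (-s)]
                have : a₀.rad ^ (-s) ≠ 0 := (Real.rpow_pos_of_pos ha₀ _).ne'
                field_simp
            _ ≤ _ := by gcongr; exact hpow k
  calc ∫⁻ ω', g ω' ∂Q = ∫⁻ ω' in (⋂ k, agreeSet ω k) ∪ ⋃ k, D k, g ω' ∂Q := by
        rw [Measure.restrict_eq_self_of_ae_mem hcover]
    _ ≤ ∫⁻ ω' in ⋂ k, agreeSet ω k, g ω' ∂Q + ∫⁻ ω' in ⋃ k, D k, g ω' ∂Q :=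
        lintegral_union_le _ _ _
    _ ≤ 0 + ∑' k, ENNReal.ofReal (6 ^ s * K * a₀.rad ^ (-s) * (1 / 2) ^ k) := by
        refine add_le_add (setLIntegral_measure_zero _ _ hI).le ?_
        exact (lintegral_iUnion_le _ _).trans (ENNReal.tsum_le_tsum hpiece)
    _ = _ := by
        rw [zero_add, ← ENNReal.ofReal_tsum_of_nonneg (fun k => by positivity)
          (summable_geometric_two.mul_left _), tsum_mul_left, tsum_geometric_two]
        congr 1; ring

end Measure

/-- **Frostman's lemma** for continuous images of Baire space: if the image of `f` has positive
`t`-dimensional Hausdorff measure and `s < t`, then some probability measure has finite `s`-energy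
with respect to the distance pulled back by `f`. -/
theorem exists_measure_energy_lt_top {E : Type*} [MetricSpace E]
    [TopologicalSpace.SeparableSpace E] [MeasurableSpace E] [BorelSpace E] {f : (ℕ → ℕ) → E}
    (hf : Continuous f) {s t : ℝ} (hs : 0 ≤ s) (hst : s < t) (hpos : μH[t] (range f) ≠ 0) :
    ∃ μ : Measure (ℕ → ℕ), IsProbabilityMeasure μ ∧
      ∫⁻ z, ∫⁻ z', edist (f z) (f z') ^ (-s) ∂μ ∂μ < ∞ := by
  have : SecondCountableTopology E := UniformSpace.secondCountable_of_separable E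
  have ht : 0 < t := hs.trans_lt hst
  obtain ⟨K, hK, hchild⟩ := exists_isChildLaw ht f hs hst
  obtain ⟨θ, hθ, hθ5, hKθ⟩ : ∃ θ : ℝ, 0 < θ ∧ θ ≤ 1 / 5 ∧ K * θ ^ (t - s) ≤ 1 / 2 := by
    have hlim : Tendsto (fun θ : ℝ => K * θ ^ (t - s)) (𝓝[>] 0) (𝓝 0) := by
      have h1 : ContinuousAt (fun θ : ℝ => K * θ ^ (t - s)) 0 :=
        (Real.continuousAt_rpow_const _ _ (Or.inr (by linarith))).const_mul K
      have h2 := h1.tendsto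
      simp only [Real.zero_rpow (show t - s ≠ 0 by linarith), mul_zero] at h2
      exact h2.mono_left nhdsWithin_le_nhds
    have h1 := hlim.eventually (ge_mem_nhds (show (0 : ℝ) < 1 / 2 by norm_num))
    have h2 : ∀ᶠ θ : ℝ in 𝓝[>] 0, θ ≤ 1 / 5 :=
      nhdsWithin_le_nhds (ge_mem_nhds (by norm_num))
    obtain ⟨θ, ⟨h1, h2⟩, h3⟩ := ((h1.and h2).and self_mem_nhdsWithin).exists
    exact ⟨θ, h3, h2, h1⟩
  obtain ⟨z₀, hz₀⟩ : ∃ z, f z ∉ exceptionalSet ht f := by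
    by_contra! hall
    refine hpos (hausdorffMeasure_eq_zero_of_hausdorffContent_eq_zero ht
      (measure_mono_null ?_ (hausdorffContent_exceptionalSet ht f)))
    rintro _ ⟨z, rfl⟩
    exact hall z
  obtain ⟨r₀, -, hgood⟩ := exists_isGoodNode_of_notMem_exceptionalSet ht f 0 z₀ hz₀ one_pos
  have hlaw : ∀ k n, ∃ p T, IsProbabilityMeasure p ∧
      (IsGoodNode ht f k n.seq n.rad → IsChildLaw ht f s θ K k n p T) := by
    intro k n
    by_cases h : IsGoodNode ht f k n.seq n.rad
    · obtain ⟨p, T, hpT⟩ := hchild θ hθ (by linarith) k n h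
      exact ⟨p, T, hpT.isProbabilityMeasure, fun _ => hpT⟩
    -- Bad nodes get an arbitrary probability law so that the chain is defined everywhere; it almost
    -- surely never visits them.
    · exact ⟨Measure.dirac n, ∅, inferInstance, fun h' => absurd h' h⟩
  choose M T hMp hMT using hlaw
  obtain ⟨Q, hQp, hQ₀, hQ⟩ := exists_markovChain (⟨z₀, r₀⟩ : TreeNode) M
  have hM : IsTreeLaw ht f s θ K M T := hMT
  have hpaths := ae_mem_treePaths hQ₀ hQ hM hgood
  refine ⟨Q.map pathLimit, Measure.isProbabilityMeasure_map measurable_pathLimit.aemeasurable, ?_⟩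
  have hfm : Measurable f := hf.measurable
  have hmeas : Measurable fun p : (ℕ → ℕ) × (ℕ → ℕ) => edist (f p.1) (f p.2) ^ (-s) :=
    ((hfm.comp measurable_fst).edist (hfm.comp measurable_snd)).pow_const _
  rw [lintegral_map (hmeas.lintegral_prod_right') measurable_pathLimit]
  have hinner : ∀ z, ∫⁻ z', edist (f z) (f z') ^ (-s) ∂(Q.map pathLimit) =
      ∫⁻ ω', edist (f z) (f (pathLimit ω')) ^ (-s) ∂Q := fun z =>
    lintegral_map (hmeas.comp measurable_prodMk_left) measurable_pathLimit
  simp only [hinner]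
  calc _ ≤ ∫⁻ _, ENNReal.ofReal (2 * (6 ^ s * K * r₀ ^ (-s))) ∂Q := by
        refine lintegral_mono_ae ?_
        filter_upwards [hpaths] with ω hω
        exact lintegral_potential_le hQ₀ hQ hM hgood hf hK hθ hθ5 hs hst hKθ hω
    _ < ∞ := by
        rw [lintegral_const, measure_univ, mul_one]
        exact ENNReal.ofReal_lt_top

/-! ### Capacitability, measurable projection, and measurability in the parameter. -/

section Analytic

/-- Inner approximation of the outer measure of a continuous image of Baire space by compact
sets. -/
lemma exists_isCompact_le_measure_image {W : Type*} [TopologicalSpace W] [MeasurableSpace W]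
    {ρ : Measure W} [ρ.OuterRegular] {g : (ℕ → ℕ) → W} (hg : Continuous g) {a : ℝ≥0∞}
    (ha : a < ρ (range g)) : ∃ K : Set (ℕ → ℕ), IsCompact K ∧ a ≤ ρ (g '' K) := by
  -- Outer measure is continuous along increasing unions of arbitrary sets, so one coordinate at a
  -- time can be bounded while keeping the measure above `a`.
  have hstep : ∀ (k : ℕ) (C : {C : Set (ℕ → ℕ) // a < ρ (g '' C)}),
      ∃ m : ℕ, a < ρ (g '' (C.1 ∩ {z | z k ≤ m})) := by
    rintro k ⟨C, hC⟩
    have hU : g '' C = ⋃ m : ℕ, g '' (C ∩ {z | z k ≤ m}) := by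
      rw [← image_iUnion, ← inter_iUnion]
      congr 1
      ext z
      simpa using fun _ => ⟨z k, le_rfl⟩
    have hmono : Monotone fun m : ℕ => g '' (C ∩ {z | z k ≤ m}) := fun m m' h =>
      image_mono (inter_subset_inter_right _ fun z (hz : z k ≤ m) => hz.trans h)
    rw [hU, hmono.measure_iUnion, lt_iSup_iff] at hC
    exact hC
  choose m hm using hstep
  let C : ℕ → {C : Set (ℕ → ℕ) // a < ρ (g '' C)} := fun k =>
    Nat.rec ⟨univ, by rwa [image_univ]⟩ (fun k C => ⟨_, hm k C⟩) k
  have hCsucc : ∀ k, (C (k + 1)).1 = (C k).1 ∩ {z | z k ≤ m k (C k)} := fun k => rfl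
  set n : ℕ → ℕ := fun k => m k (C k) with hn
  have hCmem : ∀ k z, z ∈ (C k).1 → ∀ i < k, z i ≤ n i := by
    intro k
    induction k with
    | zero => intro z _ i hi; omega
    | succ k ih =>
      intro z hz i hi
      rw [hCsucc] at hz
      rcases Nat.lt_succ_iff_lt_or_eq.1 hi with h | rfl
      exacts [ih z hz.1 i h, hz.2]
  set K : Set (ℕ → ℕ) := Set.pi univ fun i => Iic (n i) with hK
  have hKc : IsCompact K := isCompact_univ_pi fun i => (finite_Iic (n i)).isCompact
  refine ⟨K, hKc, ?_⟩
  rw [(g '' K).measure_eq_iInf_isOpen ρ]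
  refine le_iInf₂ fun O hO => le_iInf fun hOo => ?_
  suffices h : ∃ k, g '' (C k).1 ⊆ O by
    obtain ⟨k, hk⟩ := h
    exact (C k).2.le.trans (measure_mono hk)
  by_contra! hcon
  have hex : ∀ k, ∃ z ∈ (C k).1, g z ∉ O := fun k => by
    obtain ⟨_, ⟨z, hz, rfl⟩, h⟩ := not_subset.1 (hcon k)
    exact ⟨z, hz, h⟩
  choose z hzC hzO using hex
  -- Truncation moves `z k` into the compact box without changing its first `k` coordinates, so a
  -- subsequence of the original points has the same limit.
  obtain ⟨w, hwK, φ, hφ, hlim⟩ := hKc.tendsto_subseq (x := fun k i => min (z k i) (n i))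
    (fun k => mem_univ_pi.2 fun i => mem_Iic.2 (min_le_right _ _))
  have hlim2 : Tendsto (fun k => z (φ k)) atTop (𝓝 w) := by
    rw [tendsto_pi_nhds] at hlim ⊢
    intro i
    refine (hlim i).congr' ?_
    filter_upwards [eventually_gt_atTop i] with k hk
    exact min_eq_left (hCmem _ _ (hzC _) i (hk.trans_le (hφ.id_le k)))
  have hev := ((hg.tendsto w).comp hlim2).eventually
    (hOo.mem_nhds (hO ⟨w, hwK, rfl⟩))
  obtain ⟨k, hk⟩ := hev.exists
  exact hzO _ hk

/-- Analytic sets are universally measurable. -/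
lemma MeasureTheory.AnalyticSet.nullMeasurableSet {W : Type*} [TopologicalSpace W] [T2Space W]
    [MeasurableSpace W] [BorelSpace W] {ρ : Measure W} [IsFiniteMeasure ρ] [ρ.OuterRegular]
    {S : Set W} (hS : AnalyticSet S) : NullMeasurableSet S ρ := by
  rw [AnalyticSet] at hS
  rcases hS with rfl | ⟨g, hg, rfl⟩
  · exact MeasurableSet.empty.nullMeasurableSet
  rcases eq_or_ne (ρ (range g)) 0 with h0 | h0
  · exact NullMeasurableSet.of_null h0
  obtain ⟨a, -, ha, hlim⟩ := exists_seq_strictMono_tendsto' (pos_iff_ne_zero.2 h0)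
  choose K hK hKa using fun j => exists_isCompact_le_measure_image hg (ha j).2
  have hU : MeasurableSet (⋃ j, g '' K j) :=
    MeasurableSet.iUnion fun j => ((hK j).image hg).isClosed.measurableSet
  refine hU.nullMeasurableSet.congr (ae_eq_of_subset_of_measure_ge ?_ ?_ hU.nullMeasurableSet
    (measure_ne_top _ _))
  · exact iUnion_subset fun j => image_subset_range _ _
  · exact le_of_tendsto' hlim fun j => (hKa j).trans (measure_mono (subset_iUnion (fun j => g '' K j) j))

/-- A measurable subset of a product is the pull-back of a measurable set along a map of the first
factor to Cantor space. -/
lemma exists_preimage_prodMap_eq {W Z : Type*} [MeasurableSpace W] [MeasurableSpace Z]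
    {M : Set (W × Z)} (hM : MeasurableSet M) :
    ∃ φ : W → ℕ → Bool, Measurable φ ∧ ∃ M₀ : Set ((ℕ → Bool) × Z), MeasurableSet M₀ ∧
      M = Prod.map φ id ⁻¹' M₀ := by
  classical
  induction M, hM using MeasurableSpace.induction_on_inter generateFrom_prod.symm
    isPiSystem_prod with
  | empty => exact ⟨fun _ _ => true, measurable_const, ∅, MeasurableSet.empty, by simp⟩
  | basic M hM =>
    obtain ⟨A, hA, B, hB, rfl⟩ := hM
    refine ⟨fun w _ => decide (w ∈ A), measurable_pi_iff.2 fun _ => ?_,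
      {x | x 0 = true} ×ˢ B, (measurableSet_eval_eq _ _).prod hB, ?_⟩
    · refine measurable_to_bool ?_
      have : (fun w => decide (w ∈ A)) ⁻¹' {true} = A := by ext; simp
      rwa [this]
    · ext ⟨w, z⟩; simp
  | compl M hM ih =>
    obtain ⟨φ, hφ, M₀, hM₀, rfl⟩ := ih
    exact ⟨φ, hφ, M₀ᶜ, hM₀.compl, rfl⟩
  | iUnion M _ hM ih =>
    choose φ hφ M₀ hM₀ h using ih
    have hsec : ∀ n, Measurable fun (x : ℕ → Bool) (j : ℕ) => x (Nat.pair n j) := fun n =>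
      measurable_pi_iff.2 fun j => measurable_pi_apply _
    -- The countably many codes are interleaved into one by the pairing function.
    refine ⟨fun w m => φ m.unpair.1 w m.unpair.2, measurable_pi_iff.2 fun m =>
      (measurable_pi_apply _).comp (hφ _),
      ⋃ n, Prod.map (fun (x : ℕ → Bool) (j : ℕ) => x (Nat.pair n j)) id ⁻¹' M₀ n,
      MeasurableSet.iUnion fun n => ((hsec n).prodMap measurable_id) (hM₀ n), ?_⟩
    rw [preimage_iUnion]
    congr 1
    funext n
    rw [h n]
    ext ⟨w, z⟩
    simp

/-- **Measurable projection theorem**: projections along Baire space of measurable sets are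
universally measurable. -/
lemma nullMeasurableSet_image_fst {W : Type*} [MeasurableSpace W] {ρ : Measure W} [SFinite ρ]
    {M : Set (W × (ℕ → ℕ))} (hM : MeasurableSet M) : NullMeasurableSet (Prod.fst '' M) ρ := by
  obtain ⟨φ, hφ, M₀, hM₀, rfl⟩ := exists_preimage_prodMap_eq hM
  have himage : Prod.fst '' (Prod.map φ id ⁻¹' M₀) = φ ⁻¹' (Prod.fst '' M₀) := by
    ext w
    simp
  rw [himage]
  have han : AnalyticSet (Prod.fst '' M₀) := hM₀.analyticSet_image measurable_fst
  -- On Cantor space the projection is analytic, hence measurable up to null sets for the image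
  -- measure; this pulls back along `φ`.
  have hnull : NullMeasurableSet (Prod.fst '' M₀) (ρ.toFinite.map φ) := han.nullMeasurableSet
  exact (hnull.preimage (hφ.quasiMeasurePreserving _)).mono_ac (absolutelyContinuous_toFinite ρ)

/-- Measures of images depend measurably on the parameter. -/
lemma aemeasurable_measure_range {Λ Y : Type*} [MeasurableSpace Λ] {P : Measure Λ} [SFinite P]
    [MeasurableSpace Y] [MeasurableEq Y] {η : Measure Y} [SFinite η] {g : Λ → (ℕ → ℕ) → Y}
    (hg : Measurable (Function.uncurry g)) : AEMeasurable (fun ω => η (range (g ω))) P := by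
  set M : Set ((Λ × Y) × (ℕ → ℕ)) := {p | g p.1.1 p.2 = p.1.2} with hMdef
  have hM : MeasurableSet M := measurableSet_eq_fun
    (hg.comp (measurable_fst.fst.prodMk measurable_snd)) measurable_fst.snd
  have hnull : NullMeasurableSet (Prod.fst '' M) (P.prod η) := nullMeasurableSet_image_fst hM
  obtain ⟨G, hG, hGM⟩ := hnull
  refine ⟨fun ω => η (Prod.mk ω ⁻¹' G), measurable_measure_prodMk_left hG, ?_⟩
  filter_upwards [Measure.ae_ae_of_ae_prod hGM] with ω hω
  refine measure_congr ?_
  filter_upwards [hω] with y hy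
  refine Eq.trans ?_ hy
  refine propext ?_
  change y ∈ range (g ω) ↔ (ω, y) ∈ Prod.fst '' M
  simp [hMdef]

end Analytic

/-! ### Comparing an image measure with a regular measure. -/

section Vitali

variable {Y : Type*} [MetricSpace Y] [TopologicalSpace.SeparableSpace Y] [MeasurableSpace Y]
  [BorelSpace Y]

/-- Comparison of two measures on a set where one has large lower density along all small radii
and the other has small density along some small radii. -/
lemma measure_le_of_density {ν η : Measure Y} [η.OuterRegular] {κ M c : ℝ}
    (hM : 0 < M) (hc : 0 < c) {G : Set Y}
    (hη : ∀ y ∈ G, ∀ᶠ r : ℝ in 𝓝[>] 0, ENNReal.ofReal (c * r ^ κ) ≤ η (closedBall y r))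
    (hν : ∀ y ∈ G, ∃ᶠ r : ℝ in 𝓝[>] 0, ν (closedBall y r) ≤ ENNReal.ofReal (M * r ^ κ)) :
    ν G ≤ ENNReal.ofReal (M * 5 ^ κ / c) * η G := by
  set L := ENNReal.ofReal (M * 5 ^ κ / c) with hL
  have hL0 : L ≠ 0 := by
    have : 0 < L := by positivity
    exact this.ne'
  have hopen : ∀ O : Set Y, G ⊆ O → IsOpen O → ν G ≤ L * η O := by
    intro O hGO hO
    -- The lower bound for `η` holds at all small radii, so it may be used at `r / 5`: disjoint
    -- balls of radius `r / 5` are summed by `η`, while the balls of radius `r` cover.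
    have hex : ∀ y, y ∈ G → ∃ r : ℝ, 0 < r ∧ r ≤ 1 ∧ closedBall y r ⊆ O ∧
        ν (closedBall y r) ≤ ENNReal.ofReal (M * r ^ κ) ∧
        ENNReal.ofReal (c * (r / 5) ^ κ) ≤ η (closedBall y (r / 5)) := by
      intro y hy
      have h5 : Tendsto (fun r : ℝ => r / 5) (𝓝[>] 0) (𝓝[>] 0) := by
        refine tendsto_nhdsWithin_iff.2 ⟨?_, ?_⟩
        · have : Tendsto (fun r : ℝ => r / 5) (𝓝 0) (𝓝 (0 / 5)) := tendsto_id.div_const 5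
          rw [zero_div] at this
          exact this.mono_left nhdsWithin_le_nhds
        · filter_upwards [self_mem_nhdsWithin] with r hr
          have : (0 : ℝ) < r := hr
          exact mem_Ioi.2 (by positivity)
      have e1 := h5.eventually (hη y hy)
      have e2 : ∀ᶠ r : ℝ in 𝓝[>] 0, r ≤ 1 := nhdsWithin_le_nhds (ge_mem_nhds one_pos)
      have e3 : ∀ᶠ r : ℝ in 𝓝[>] 0, closedBall y r ⊆ O := by
        obtain ⟨ε, hε, hεO⟩ := nhds_basis_closedBall.mem_iff.1 (hO.mem_nhds (hGO hy))
        have : ∀ᶠ r : ℝ in 𝓝[>] 0, r ≤ ε := nhdsWithin_le_nhds (ge_mem_nhds hε)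
        filter_upwards [this] with r hr
        exact (closedBall_subset_closedBall hr).trans hεO
      obtain ⟨r, h1, h2, h3, h4, h5⟩ := ((hν y hy).and_eventually
        (e1.and (e2.and (e3.and self_mem_nhdsWithin)))).exists
      exact ⟨r, h5, h3, h4, h1, h2⟩
    choose! r hr0 hr1 hrO hrν hrη using hex
    obtain ⟨u, huG, hdisj, hcov⟩ :=
      Vitali.exists_disjoint_subfamily_covering_enlargement_closedBall G id (fun y => r y / 5) 1
        (fun y hy => by linarith [hr1 y hy, hr0 y hy]) 5 (by norm_num)
    have hu : u.Countable := hdisj.countable_of_nonempty_interior fun y hy =>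
      ⟨y, ball_subset_interior_closedBall (mem_ball_self (by linarith [hr0 y (huG hy)]))⟩
    have hsub : G ⊆ ⋃ y ∈ u, closedBall y (r y) := by
      intro y hy
      obtain ⟨b, hb, hsub⟩ := hcov y hy
      have := hsub (mem_closedBall_self (by linarith [hr0 y hy]))
      simp only [id, mul_div_cancel₀ _ (show (5 : ℝ) ≠ 0 by norm_num)] at this
      exact mem_iUnion₂.2 ⟨b, hb, this⟩
    calc ν G ≤ ∑' y : u, ν (closedBall y (r y)) :=
          (measure_mono hsub).trans (measure_biUnion_le ν hu _)
      _ ≤ ∑' y : u, L * η (closedBall y (r y / 5)) := by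
          refine ENNReal.tsum_le_tsum fun y => (hrν y (huG y.2)).trans ?_
          have hy := hr0 y (huG y.2)
          refine le_trans (le_of_eq ?_) (mul_le_mul_right (hrη y (huG y.2)) L)
          rw [hL, ← ENNReal.ofReal_mul (by positivity), Real.div_rpow hy.le (by norm_num)]
          congr 1
          field_simp
      _ = L * ∑' y : u, η (closedBall y (r y / 5)) := ENNReal.tsum_mul_left
      _ = L * η (⋃ y ∈ u, closedBall y (r y / 5)) := by
          rw [measure_biUnion (f := fun y => closedBall y (r y / 5)) hu hdisj
            fun y _ => isClosed_closedBall.measurableSet]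
      _ ≤ L * η O := by
          gcongr
          refine iUnion₂_subset fun y hy => ?_
          refine (closedBall_subset_closedBall ?_).trans (hrO y (huG hy))
          linarith [hr0 y (huG hy)]
  rw [mul_comm, ← ENNReal.div_le_iff_le_mul (Or.inl hL0) (Or.inl ENNReal.ofReal_ne_top),
    G.measure_eq_iInf_isOpen η]
  refine le_iInf₂ fun O hO => le_iInf fun hOo => ?_
  rw [ENNReal.div_le_iff_le_mul (Or.inl hL0) (Or.inl ENNReal.ofReal_ne_top), mul_comm]
  exact hopen O hO hOo

variable {Ω : Type*} [MeasurableSpace Ω]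

/-- The lower `κ`-density of `h_* μ` at `h z`, along dyadic radii. -/
def imageDensity (μ : Measure Ω) (κ : ℝ) (h : Ω → Y) (z : Ω) : ℝ≥0∞ :=
  liminf (fun n : ℕ => μ {z' | dist (h z) (h z') ≤ (1 / 2) ^ n} /
    ENNReal.ofReal (((1 / 2) ^ n) ^ κ)) atTop

/-- Apply `measure_le_of_density` to `μ.map h` on the image of the set. Neither set needs to be
measurable, since `Measure.le_map_apply` holds for all sets. -/
lemma measure_imageDensity_lt_le {μ : Measure Ω} {h : Ω → Y} (hh : Measurable h) {η : Measure Y}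
    [η.OuterRegular] {κ M c : ℝ} (hM : 0 < M) (hc : 0 < c) :
    μ {z | imageDensity μ κ h z < ENNReal.ofReal M ∧ ENNReal.ofReal c < kappaDensity κ η (h z)} ≤
      ENNReal.ofReal (M * 5 ^ κ / c) * η (range h) := by
  set S := {z | imageDensity μ κ h z < ENNReal.ofReal M ∧
    ENNReal.ofReal c < kappaDensity κ η (h z)} with hS
  have hpos : ∀ᶠ r : ℝ in 𝓝[>] 0, 0 < r := self_mem_nhdsWithin
  calc μ S ≤ μ (h ⁻¹' (h '' S)) := measure_mono (subset_preimage_image h S)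
    _ ≤ μ.map h (h '' S) := Measure.le_map_apply hh.aemeasurable _
    _ ≤ ENNReal.ofReal (M * 5 ^ κ / c) * η (h '' S) := by
        refine measure_le_of_density hM hc ?_ ?_
        · rintro _ ⟨z, hz, rfl⟩
          filter_upwards [eventually_lt_of_lt_liminf hz.2, hpos] with r hr hr0
          have hrκ : 0 < r ^ κ := Real.rpow_pos_of_pos hr0 κ
          rw [ENNReal.ofReal_mul hc.le]
          exact ENNReal.mul_le_of_le_div hr.le
        · rintro _ ⟨z, hz, rfl⟩
          have hfreq := frequently_lt_of_liminf_lt (by isBoundedDefault) hz.1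
          have hlim : Tendsto (fun n : ℕ => ((1 : ℝ) / 2) ^ n) atTop (𝓝[>] 0) :=
            tendsto_nhdsWithin_iff.2 ⟨tendsto_pow_atTop_nhds_zero_of_lt_one (by norm_num)
              (by norm_num), Eventually.of_forall fun n => mem_Ioi.2 (by positivity)⟩
          refine hlim.frequently (hfreq.mono fun n hn => ?_)
          rw [Measure.map_apply hh isClosed_closedBall.measurableSet, ENNReal.ofReal_mul hM.le]
          have hset : h ⁻¹' closedBall (h z) ((1 / 2) ^ n) =
              {z' | dist (h z) (h z') ≤ (1 / 2) ^ n} := by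
            ext z'; simp [dist_comm]
          rw [hset]
          refine (ENNReal.div_le_iff_le_mul (Or.inl ?_) (Or.inl ENNReal.ofReal_ne_top)).1 hn.le
          have : (0 : ℝ≥0∞) < ENNReal.ofReal (((1 / 2) ^ n) ^ κ) := by positivity
          exact this.ne'
    _ ≤ _ := by gcongr; exact image_subset_range _ _

/-- Almost every point has finite image density and positive `η`-density, hence lies in one of
countably many sets with uniform bounds. If `η (range h)` vanished, all of these would be null. -/
lemma measure_range_pos_of_lintegral_lt_top {μ : Measure Ω} [IsProbabilityMeasure μ] {h : Ω → Y}
    (hh : Measurable h) {η : Measure Y} {κ : ℝ} (hη : IsKappaRegular κ η)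
    (hLm : Measurable (imageDensity μ κ h)) (hL : ∫⁻ z, imageDensity μ κ h z ∂μ < ∞) :
    0 < η (range h) := by
  have := hη.outerRegular
  rw [pos_iff_ne_zero]
  intro h0
  have hnull : μ (⋃ n : ℕ, {z | imageDensity μ κ h z < ENNReal.ofReal ((n : ℝ) + 1) ∧
      ENNReal.ofReal (1 / ((n : ℝ) + 1)) < kappaDensity κ η (h z)}) = 0 := by
    refine measure_iUnion_null fun n => le_antisymm ?_ zero_le
    refine (measure_imageDensity_lt_le hh (by positivity) (by positivity)).trans ?_
    rw [h0, mul_zero]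
  obtain ⟨z, h1, h2⟩ := ((ae_lt_top hLm hL.ne).and
    (measure_eq_zero_iff_ae_notMem.1 hnull)).exists
  refine h2 (mem_iUnion.2 ?_)
  have h3 := hη.density_pos (h z)
  obtain ⟨a, ha0, ha⟩ := ENNReal.lt_iff_exists_real_btwn.1 h3
  obtain ⟨n₁, hn₁⟩ := ENNReal.exists_nat_gt h1.ne
  have hapos : 0 < a := by simpa using ha.1
  obtain ⟨n₂, hn₂⟩ := exists_nat_one_div_lt hapos
  refine ⟨max n₁ n₂, hn₁.trans_le ?_, lt_of_le_of_lt (ENNReal.ofReal_le_ofReal ?_) ha.2⟩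
  · rw [← ENNReal.ofReal_natCast]
    refine ENNReal.ofReal_le_ofReal ?_
    have : (n₁ : ℝ) ≤ ((max n₁ n₂ : ℕ) : ℝ) := by exact_mod_cast le_max_left _ _
    linarith
  · refine le_trans ?_ hn₂.le
    have : (n₂ : ℝ) ≤ ((max n₁ n₂ : ℕ) : ℝ) := by exact_mod_cast le_max_right _ _
    gcongr

/-- By Markov's inequality the density is below `M = 2 * J + 1` on at least half of the mass, which
gives `1 / 2 ≤ (M * 5 ^ κ / c) * η (range h)`. The `+ 1` keeps `M` positive when `J = 0`. -/
lemma inv_measure_range_le {μ : Measure Ω} [IsProbabilityMeasure μ] {h : Ω → Y}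
    (hh : Measurable h) {η : Measure Y} [η.OuterRegular] {κ c : ℝ} (hc : 0 < c)
    (hη : ∀ y, ENNReal.ofReal c < kappaDensity κ η y) (hLm : Measurable (imageDensity μ κ h)) :
    (η (range h))⁻¹ ≤
      ENNReal.ofReal (2 * 5 ^ κ / c) * (2 * ∫⁻ z, imageDensity μ κ h z ∂μ + 1) := by
  set J := ∫⁻ z, imageDensity μ κ h z ∂μ with hJ
  rcases eq_or_ne J ∞ with hJt | hJt
  · have : ENNReal.ofReal (2 * 5 ^ κ / c) ≠ 0 := by
      have : 0 < ENNReal.ofReal (2 * 5 ^ κ / c) := by positivity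
      exact this.ne'
    simp [hJt, ENNReal.mul_top, this]
  set M := (2 * J + 1).toReal with hMdef
  have hMt : 2 * J + 1 ≠ ∞ := by finiteness
  have hM : ENNReal.ofReal M = 2 * J + 1 := ENNReal.ofReal_toReal hMt
  have hMpos : 0 < M := ENNReal.toReal_pos (by simp) hMt
  have hge : μ {z | ENNReal.ofReal M ≤ imageDensity μ κ h z} ≤ 2⁻¹ := by
    refine (meas_ge_le_lintegral_div hLm.aemeasurable (by rw [hM]; simp)
      ENNReal.ofReal_ne_top).trans ?_
    rw [← hJ, hM]
    refine ENNReal.div_le_of_le_mul ?_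
    rw [mul_add, ← mul_assoc, ENNReal.inv_mul_cancel (by simp) (by simp), one_mul]
    exact le_self_add
  have hlt : 2⁻¹ ≤ μ {z | imageDensity μ κ h z < ENNReal.ofReal M} := by
    have hcompl : {z | imageDensity μ κ h z < ENNReal.ofReal M} =
        {z | ENNReal.ofReal M ≤ imageDensity μ κ h z}ᶜ := by ext; simp
    rw [hcompl, prob_compl_eq_one_sub (measurableSet_le measurable_const hLm)]
    refine ENNReal.le_sub_of_add_le_left (by finiteness) ?_
    exact (add_le_add_left hge _).trans_eq ENNReal.inv_two_add_inv_two
  have hmain : 2⁻¹ ≤ ENNReal.ofReal (M * 5 ^ κ / c) * η (range h) := by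
    refine hlt.trans (le_trans (measure_mono ?_)
      (measure_imageDensity_lt_le (η := η) hh hMpos hc))
    exact fun z hz => ⟨hz, hη _⟩
  have heq : ENNReal.ofReal (2 * 5 ^ κ / c) * (2 * J + 1) =
      2 * ENNReal.ofReal (M * 5 ^ κ / c) := by
    rw [← hM, ← ENNReal.ofReal_mul (by positivity), show (2 : ℝ≥0∞) = ENNReal.ofReal 2 by simp,
      ← ENNReal.ofReal_mul (by positivity)]
    congr 1; ring
  rw [heq]
  have h1 : (1 : ℝ≥0∞) ≤ 2 * ENNReal.ofReal (M * 5 ^ κ / c) * η (range h) := by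
    rw [mul_assoc]
    calc (1 : ℝ≥0∞) = 2 * 2⁻¹ := (ENNReal.mul_inv_cancel (by simp) (by simp)).symm
      _ ≤ _ := by gcongr
  rw [← one_div]
  exact ENNReal.div_le_of_le_mul h1

end Vitali

/-! ### Mean density bounded by energy. -/

section Energy

variable {Y Λ Ω : Type*} [MetricSpace Y] [SecondCountableTopology Y] [MeasurableSpace Y]
  [BorelSpace Y] [MeasurableSpace Λ] [MeasurableSpace Ω]

lemma measurableSet_dist_le {g : Λ → Ω → Y} (hg : Measurable (Function.uncurry g)) (r : ℝ) :
    MeasurableSet {p : (Λ × Ω) × Ω | dist (g p.1.1 p.1.2) (g p.1.1 p.2) ≤ r} :=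
  measurableSet_le ((hg.comp measurable_fst).dist
    (hg.comp (measurable_fst.fst.prodMk measurable_snd))) measurable_const

lemma measurable_measure_dist_le {μ : Measure Ω} [SFinite μ] {g : Λ → Ω → Y}
    (hg : Measurable (Function.uncurry g)) (r : ℝ) :
    Measurable fun p : Λ × Ω => μ {z' | dist (g p.1 p.2) (g p.1 z') ≤ r} :=
  measurable_measure_prodMk_left (measurableSet_dist_le hg r)

/-- Measurability is the reason for restricting the density to dyadic radii: the lower limit is over
a sequence. -/
lemma measurable_imageDensity {μ : Measure Ω} [SFinite μ] {g : Λ → Ω → Y}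
    (hg : Measurable (Function.uncurry g)) (κ : ℝ) :
    Measurable fun p : Λ × Ω => imageDensity μ κ (g p.1) p.2 :=
  Measurable.liminf fun _ => (measurable_measure_dist_le hg _).div_const _

lemma measurable_imageDensity_apply {μ : Measure Ω} [SFinite μ] {g : Λ → Ω → Y}
    (hg : Measurable (Function.uncurry g)) (κ : ℝ) (ω : Λ) :
    Measurable (imageDensity μ κ (g ω)) := by
  have h := (measurable_imageDensity (μ := μ) hg κ).comp (measurable_prodMk_left (x := ω))
  simpa only [Function.comp_def] using h

lemma measurable_lintegral_imageDensity {μ : Measure Ω} [SFinite μ] {g : Λ → Ω → Y}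
    (hg : Measurable (Function.uncurry g)) (κ : ℝ) :
    Measurable fun ω => ∫⁻ z, imageDensity μ κ (g ω) z ∂μ :=
  (measurable_imageDensity hg κ).lintegral_prod_right'

/-- At a fixed radius, Tonelli exchanges the mass near a point with the probability that two points
are mapped close together, and `r ^ κ` cancels. Fatou passes to the lower limit. -/
lemma lintegral_imageDensity_le {P : Measure Λ} [SFinite P] {μ : Measure Ω} [SFinite μ]
    {g : Λ → Ω → Y} (hg : Measurable (Function.uncurry g)) {κ : ℝ} {Φ : Ω → Ω → ℝ≥0∞}
    (hΦ : ∀ r : ℝ, 0 < r → ∀ z z',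
      P {ω | dist (g ω z) (g ω z') ≤ r} ≤ ENNReal.ofReal (r ^ κ) * Φ z z') :
    ∫⁻ ω, ∫⁻ z, imageDensity μ κ (g ω) z ∂μ ∂P ≤ ∫⁻ z, ∫⁻ z', Φ z z' ∂μ ∂μ := by
  have hbound : ∀ r : ℝ, 0 < r →
      ∫⁻ p : Λ × Ω, μ {z' | dist (g p.1 p.2) (g p.1 z') ≤ r} / ENNReal.ofReal (r ^ κ)
        ∂(P.prod μ) ≤ ∫⁻ z, ∫⁻ z', Φ z z' ∂μ ∂μ := by
    intro r hr
    have hS := measurableSet_dist_le hg r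
    have hr0 : ENNReal.ofReal (r ^ κ) ≠ 0 := by
      have : 0 < ENNReal.ofReal (r ^ κ) := by positivity
      exact this.ne'
    have hswap : ∀ z, ∫⁻ ω, μ {z' | dist (g ω z) (g ω z') ≤ r} ∂P =
        ∫⁻ z', P {ω | dist (g ω z) (g ω z') ≤ r} ∂μ := by
      intro z
      have hSz : MeasurableSet {q : Λ × Ω | dist (g q.1 z) (g q.1 q.2) ≤ r} :=
        (measurable_fst.prodMk measurable_const).prodMk measurable_snd hS
      have e1 := Measure.prod_apply (μ := P) (ν := μ) hSz
      have e2 := Measure.prod_apply_symm (μ := P) (ν := μ) hSz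
      exact e1.symm.trans e2
    simp only [div_eq_mul_inv]
    rw [lintegral_mul_const _ (measurable_measure_dist_le hg r),
      lintegral_prod_symm _ (measurable_measure_dist_le hg r).aemeasurable]
    simp only [hswap]
    calc (∫⁻ z, ∫⁻ z', P {ω | dist (g ω z) (g ω z') ≤ r} ∂μ ∂μ) * (ENNReal.ofReal (r ^ κ))⁻¹
        ≤ (∫⁻ z, ∫⁻ z', ENNReal.ofReal (r ^ κ) * Φ z z' ∂μ ∂μ) * (ENNReal.ofReal (r ^ κ))⁻¹ := by
          gcongr with z z'
          exact hΦ r hr z z'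
      _ = ∫⁻ z, ∫⁻ z', Φ z z' ∂μ ∂μ := by
          simp only [lintegral_const_mul' _ _ (ENNReal.ofReal_ne_top (r := r ^ κ))]
          rw [mul_comm, ← mul_assoc, ENNReal.inv_mul_cancel hr0 ENNReal.ofReal_ne_top, one_mul]
  rw [← lintegral_prod (fun p : Λ × Ω => imageDensity μ κ (g p.1) p.2)
    (measurable_imageDensity hg κ).aemeasurable]
  refine (lintegral_liminf_le fun n => (measurable_measure_dist_le hg _).div_const _).trans ?_
  refine (liminf_le_liminf (Eventually.of_forall fun n => hbound ((1 / 2) ^ n)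
    (by positivity))).trans_eq ?_
  exact liminf_const _

/-- Positivity of the measures of the images, and integrability of their inverses, for a family
of maps with finite mean energy. -/
lemma measure_range_of_lintegral_lt_top {P : Measure Λ} [IsProbabilityMeasure P]
    {μ : Measure (ℕ → ℕ)} [IsProbabilityMeasure μ] {g : Λ → (ℕ → ℕ) → Y}
    (hg : Measurable (Function.uncurry g)) {κ : ℝ}
    (hJ : ∫⁻ ω, ∫⁻ z, imageDensity μ κ (g ω) z ∂μ ∂P < ∞) :
    (∀ η : Measure Y, IsKappaRegular κ η → ∀ᵐ ω ∂P, 0 < η (range (g ω))) ∧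
    (∀ η : Measure Y, IsStronglyKappaRegular κ η → SigmaFinite η →
      AEMeasurable (fun ω => (η (range (g ω)))⁻¹) P ∧
      ∫⁻ ω, (η (range (g ω)))⁻¹ ∂P < ∞) := by
  have hgω : ∀ ω, Measurable (g ω) := fun ω => hg.comp measurable_prodMk_left
  have hJm := measurable_lintegral_imageDensity (μ := μ) hg κ
  have hLω := measurable_imageDensity_apply (μ := μ) hg κ
  refine ⟨fun η hη => ?_, fun η hη hσ => ⟨(aemeasurable_measure_range hg).inv, ?_⟩⟩
  · filter_upwards [ae_lt_top hJm hJ.ne] with ω hω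
    exact measure_range_pos_of_lintegral_lt_top (hgω ω) hη (hLω ω) hω
  · have := hη.outerRegular
    obtain ⟨c, hc, hcle⟩ := hη.density_ge
    -- A real constant strictly below `c` gives the strict density bound, and covers `c = ∞`.
    obtain ⟨a, -, ha0, hac⟩ := ENNReal.lt_iff_exists_real_btwn.1 hc
    have ha : 0 < a := by simpa using ha0
    calc ∫⁻ ω, (η (range (g ω)))⁻¹ ∂P
        ≤ ∫⁻ ω, ENNReal.ofReal (2 * 5 ^ κ / a) *
            (2 * ∫⁻ z, imageDensity μ κ (g ω) z ∂μ + 1) ∂P := lintegral_mono fun ω =>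
          inv_measure_range_le (hgω ω) ha (fun y => hac.trans_le (hcle y)) (hLω ω)
      _ = ENNReal.ofReal (2 * 5 ^ κ / a) *
            (2 * (∫⁻ ω, ∫⁻ z, imageDensity μ κ (g ω) z ∂μ ∂P) + 1) := by
          rw [lintegral_const_mul' _ _ ENNReal.ofReal_ne_top,
            lintegral_add_right _ measurable_const, lintegral_const_mul' _ _ (by simp),
            lintegral_const, measure_univ, mul_one]
      _ < ∞ := by
          have := hJ.ne
          finiteness

end Energy

/-! ### Assembly of the theorem. -/

theorem theorem1p2
    {E Y Λ : Type*}
    [MetricSpace E] [CompleteSpace E] [TopologicalSpace.SeparableSpace E]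
    [MeasurableSpace E] [BorelSpace E]
    [MetricSpace Y] [TopologicalSpace.SeparableSpace Y] [MeasurableSpace Y] [BorelSpace Y]
    [MeasurableSpace Λ] (P : Measure Λ) [IsProbabilityMeasure P]
    (X : Set E) (hX : AnalyticSet X)
    (π : Λ → X → Y) (hπ : Measurable (Function.uncurry π))
    (α κ C : ℝ) (hα : 0 < α) (hκ : 0 < κ) (hC : 0 < C)
    (htrans : IsTransversal P π α κ C)
    (hdim : ENNReal.ofReal (α * κ) < dimH X) :
    (∀ η : Measure Y, IsKappaRegular κ η →
      ∀ᵐ ω ∂P, 0 < η (Set.range (π ω))) ∧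
    (∀ η : Measure Y, IsStronglyKappaRegular κ η → SigmaFinite η →
      AEMeasurable (fun ω => (η (Set.range (π ω)))⁻¹) P ∧
      ∫⁻ ω, (η (Set.range (π ω)))⁻¹ ∂P < ∞) := by
  have : SecondCountableTopology E := UniformSpace.secondCountable_of_separable E
  have : SecondCountableTopology Y := UniformSpace.secondCountable_of_separable Y
  obtain ⟨t, ht1, ht2⟩ := ENNReal.lt_iff_exists_nnreal_btwn.1 hdim
  have hHt : μH[(t : ℝ)] X = ∞ := hausdorffMeasure_of_lt_dimH ht2
  have hst : α * κ < t := by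
    rwa [← ENNReal.ofReal_coe_nnreal, ENNReal.ofReal_lt_ofReal_iff_of_nonneg (by positivity)] at ht1
  rw [AnalyticSet] at hX
  rcases hX with rfl | ⟨f, hf, hfX⟩
  · simp at hdim
  obtain ⟨μ, hμ, hμE⟩ := exists_measure_energy_lt_top hf (s := α * κ) (by positivity) hst
    (by rw [hfX, hHt]; simp)
  have hmemX : ∀ z, f z ∈ X := fun z => hfX ▸ mem_range_self z
  set g : Λ → (ℕ → ℕ) → Y := fun ω z => π ω ⟨f z, hmemX z⟩ with hgdef
  have hg : Measurable (Function.uncurry g) := hπ.comp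
    (measurable_fst.prodMk ((hf.measurable.comp measurable_snd).subtype_mk))
  have hrange : ∀ ω, range (g ω) = range (π ω) := by
    intro ω
    refine Subset.antisymm (range_subset_iff.2 fun z => mem_range_self _) ?_
    rintro _ ⟨⟨x, hx⟩, rfl⟩
    obtain ⟨z, rfl⟩ : x ∈ range f := hfX ▸ hx
    exact ⟨z, rfl⟩
  have hΦ : ∀ r : ℝ, 0 < r → ∀ z z', P {ω | dist (g ω z) (g ω z') ≤ r} ≤
      ENNReal.ofReal (r ^ κ) * (ENNReal.ofReal C * edist (f z) (f z') ^ (-(α * κ))) := by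
    intro r hr z z'
    rcases eq_or_ne (f z) (f z') with h | h
    -- For coinciding points transversality says nothing, but the kernel is infinite.
    · have hακ : -(α * κ) < 0 := by nlinarith [mul_pos hα hκ]
      have h1 : ENNReal.ofReal (r ^ κ) ≠ 0 := by
        have : 0 < ENNReal.ofReal (r ^ κ) := by positivity
        exact this.ne'
      have h2 : ENNReal.ofReal C ≠ 0 := by simpa using hC
      rw [h, edist_self, ENNReal.zero_rpow_of_neg hακ, ENNReal.mul_top h2, ENNReal.mul_top h1]
      exact le_top
    · have hd : 0 < dist (f z) (f z') := dist_pos.2 h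
      set d := dist (f z) (f z') with hdd
      -- This `δ` makes the threshold `δ * d ^ α` equal to `r`.
      have h1 := htrans (r * d ^ (-α)) (by positivity) ⟨f z, hmemX z⟩ ⟨f z', hmemX z'⟩
        fun heq => h (congrArg Subtype.val heq)
      rw [Subtype.dist_eq, ← hdd, mul_assoc, ← Real.rpow_add hd, neg_add_cancel, Real.rpow_zero,
        mul_one] at h1
      refine h1.trans_eq ?_
      rw [edist_dist, ← hdd, ENNReal.ofReal_rpow_of_pos hd, ← ENNReal.ofReal_mul hC.le,
        ← ENNReal.ofReal_mul (by positivity), Real.mul_rpow hr.le (by positivity),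
        ← Real.rpow_mul hd.le]
      congr 1
      rw [neg_mul]
      ring
  have hJ : ∫⁻ ω, ∫⁻ z, imageDensity μ κ (g ω) z ∂μ ∂P < ∞ := by
    refine (lintegral_imageDensity_le hg hΦ).trans_lt ?_
    simp only [lintegral_const_mul' _ _ (ENNReal.ofReal_ne_top (r := C))]
    exact ENNReal.mul_lt_top ENNReal.ofReal_lt_top hμE
  simpa only [hrange] using measure_range_of_lintegral_lt_top hg hJ

end
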